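/- **Conventions.** A represented space is a set $X$ with a surjective partial map $\delta_X:\subseteq\mathbb N^{\mathbb N}\to X$. A problem is a partial multi-valued map $f:\subseteq X\rightrightarrows Y$ between represented spaces, with $\mathrm{dom}(f)=\{x: f(x)\neq\emptyset\}$. A partial function $F:\subseteq\mathbb N^{\mathbb N}\to\mathbb N^{\mathbb N}$ realizes $f$, written $F\vdash f$, if $\delta_YF(p)\in f\delta_X(p)$ for all $p\in\mathrm{dom}(f\delta_X)$. Let $f^{\mathrm r}=\delta_Y^{-1}\circ f\circ\delta_X$. We write $f\le_{\mathrm W}g$ if there are computable $H,K:\subseteq\mathbb N^{\mathbb N}\to\mathbb N^{\mathbb N}$ with $H\langle\mathrm{id},GK\rangle\vdash f$ for all $G\vdash g$. The completion $\overline X=X\cup\{\bot\}$ has the total representation $\delta_{\overline X}(p)=\delta_X(p-1)$ if this is defined and $\bot$ otherwise, where $p-1$ is the concatenation of $p(0)-1,p(1)-1,\dots$ with $0-1$ read as the empty word. The completion $\overline f:\overline X\rightrightarrows\overline Y$ equals $f(x)$ for $x\in\mathrm{dom}(f)$ and $\overline Y$ otherwise. The parallelization of $f$ is $\widehat f((x_n)_n)=\prod_n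 f(x_n)$ on $\mathrm{dom}(f)^{\mathbb N}$. The coproduct $f\sqcup g$ is the disjoint union of $f$ and $g$, and $(f\sqcap g)(x,u)=f(x)\sqcup g(u)$ (disjoint union of sets) on $\mathrm{dom}(f)\times\mathrm{dom}(g)$. Let $(\varphi_n)_{n\in\mathbb N}$ be a Gödel numbering of the computable functions $:\subseteq\mathbb N^{\mathbb N}\to\mathbb N^{\mathbb N}$ (every such function has an extension $\varphi_n$, and the utm- and smn-theorems hold; for definiteness, the standard one obtained from programs of partial recursive functions run on finite prefixes of the input), and let $$(g\twoheadrightarrow f)(p)=\{\langle n,k,q\rangle:\emptyset\ne\varphi_n\langle q,g^{\mathrm r}\circ\varphi_k(p)\rangle\subseteq f^{\mathrm r}(p)\},$$ except that $(g\twoheadrightarrow f)=\infty$ if $g$ is nowhere defined and $f$ is not. An additional problem $\infty$ is adjoined as top element of $\le_{\mathrm W}$, with $f\sqcap\infty=\infty\sqcap f=f$, $f\sqcup\infty=\infty\sqcup f=\infty$, $\overline\infty=\widehat\infty=\infty$, $(\infty\twoheadrightarrow f)=0$ (the nowhere defined problem) for all $f$, and $(g\twoheadrightarrow\infty)=\infty$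 for $g\neq\infty$. Let $f\le_{\mathrm{ptW}}g$ mean $f\le_{\mathrm W}\widehat{\overline g}$, and let $\mathcal W_{\mathrm{ptW}}$ be the class of problems including $\infty$ modulo $\equiv_{\mathrm{ptW}}$, with meet induced by $\widehat{\overline f}\sqcap\widehat{\overline g}$, join induced by $f\sqcup g$, implication $g\Rrightarrow f$ induced by $\widehat{\overline g}\twoheadrightarrow\widehat{\overline f}$, bottom $1=[\mathrm{id}_{\mathbb N^{\mathbb N}}]$ and top $[\infty]$. For $A,B\subseteq\mathbb N^{\mathbb N}$ let $A\le_{\mathrm M}B$ mean that some computable $F:\subseteq\mathbb N^{\mathbb N}\to\mathbb N^{\mathbb N}$ satisfies $B\subseteq\mathrm{dom}(F)$ and $F(B)\subseteq A$. Let $\mathcal M$ be the set of Medvedev degrees (classes of $\equiv_{\mathrm M}$), with meet induced by $A\otimes B=0A\cup1B$, join induced by $A\oplus B=\langle A\times B\rangle$, implication induced by $B\to A=\{\langle n,q\rangle:(\forall p\in B)\ \varphi_n\langle q,p\rangle\in A\}$, bottom $[\mathbb N^{\mathbb N}]$ and top $[\emptyset]$. For nonempty $A\subseteq\mathbb N^{\mathbb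 N}$ let $c_A:\mathbb N^{\mathbb N}\rightrightarrows\mathbb N^{\mathbb N}$, $p\mapsto A$, and let $c_\emptyset=\infty$. A Brouwer algebra is the order dual of a Heyting algebra: a bounded lattice with an operation $\to$ such that $x\le y\vee z\iff(y\to x)\le z$. **Theorem (Embedding of the Medvedev lattice).** With the operations above, $\mathcal M$ and $\mathcal W_{\mathrm{ptW}}$ are (well-defined) Brouwer algebras, and $c:\mathcal M\to\mathcal W_{\mathrm{ptW}}$, $[A]\mapsto[c_A]$, is a well-defined Brouwer algebra embedding: it is injective, satisfies $a\le b\iff c(a)\le c(b)$, and preserves meets, joins, implications, bottom and top. -/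

import Mathlib

namespace MedvedevWeihrauch

/-! ### Baire space, pairings, computable functions -/

/-- Baire space `ℕ^ℕ`. -/
abbrev Baire : Type := ℕ → ℕ

/-- The finite prefix `p(0), …, p(j-1)`. -/
def initSeg (p : Baire) (j : ℕ) : List ℕ := (List.range j).map p

/-- The concatenation `n p` of a number `n` with a sequence `p`; also used as the tuple `⟨n, p⟩`. -/
def cons (n : ℕ) (p : Baire) : Baire
  | 0 => n
  | k + 1 => p k

/-- `p` without its first entry. -/
def tail (p : Baire) : Baire := fun k => p (k + 1)

/-- Removing a first entry that was put in front of `p` gives back `p`. -/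
theorem tail_cons (n : ℕ) (p : Baire) : tail (cons n p) = p := rfl

/-- `⟨p, q⟩(2n) = p(n)` and `⟨p, q⟩(2n+1) = q(n)`. -/
def pair (p q : Baire) : Baire := fun n => if n % 2 = 0 then p (n / 2) else q (n / 2)

/-- The first projection of a binary tuple. -/
def fst (r : Baire) : Baire := fun n => r (2 * n)

/-- The second projection of a binary tuple. -/
def snd (r : Baire) : Baire := fun n => r (2 * n + 1)

/-- The `n`-th projection of a countable tuple, `⟨p₀, p₁, …⟩⟨n, k⟩ = pₙ(k)`, with a computable
bijective pairing of natural numbers. -/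
def proj (n : ℕ) (r : Baire) : Baire := fun k => r (Nat.pair n k)

/-- `F :⊆ ℕ^ℕ → ℕ^ℕ` is computable: some partial recursive `g` computes, from longer and longer
finite prefixes of the input `p ∈ dom F` and from a position `m`, the value `F(p)(m)`, and nothing
else. No condition is imposed on inputs outside `dom F`. -/
def IsComputable (F : Baire →. Baire) : Prop :=
  ∃ g : List ℕ × ℕ →. ℕ, Partrec g ∧
    ∀ p q, q ∈ F p → ∀ m v, q m = v ↔ ∃ j, v ∈ g (initSeg p j, m)

/-- The value at position `m` of the `n`-th computable function on input `p`. The program with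
number `n` is run on finite prefixes of `p`; the search dovetails over pairs
`i = (prefix length, number of steps)` and returns the first result. -/
def phiVal (n : ℕ) (p : Baire) (m : ℕ) : Part ℕ :=
  Nat.rfindOpt fun i =>
    Nat.Partrec.Code.evaln i.unpair.2 (Denumerable.ofNat Nat.Partrec.Code n)
      (Nat.pair (Encodable.encode (initSeg p i.unpair.1)) m)

/-- The Gödel numbering `φ` of the computable functions `:⊆ ℕ^ℕ → ℕ^ℕ`; `φₙ(p)` is defined if and
only if all its entries are. -/
def phi (n : ℕ) : Baire →. Baire := fun p =>
  ⟨∀ m, (phiVal n p m).Dom, fun h m => (phiVal n p m).get (h m)⟩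

/-! ### Represented spaces -/

/-- A represented space: a set with a surjective partial map from Baire space onto it. (Such a set
has at most the cardinality of the continuum, so that `Type` loses no generality.) -/
structure RepSpace where
  carrier : Type
  rep : Baire →. carrier
  surj : ∀ x, ∃ p, x ∈ rep p

/-- The binary tupling is inverted by its projections. -/
theorem fst_pair (p q : Baire) : fst (pair p q) = p := by
  funext n; simp [fst, pair]

/-- The binary tupling is inverted by its projections. -/
theorem snd_pair (p q : Baire) : snd (pair p q) = q := by
  funext n
  have h : (2 * n + 1) / 2 = n := by omega
  simp [snd, pair, Nat.add_mod, h]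

/-- The sequence `p - 1`: the concatenation of `p(0) - 1, p(1) - 1, …`, where `0 - 1` is the empty
word. As an element of Baire space it is defined if and only if `p` has infinitely many nonzero
entries. -/
noncomputable def dec (p : Baire) : Part Baire :=
  ⟨{n | p n ≠ 0}.Infinite, fun _ k => p (Nat.nth (fun n => p n ≠ 0) k) - 1⟩

/-- `(p + 1) - 1 = p`. -/
theorem dec_succ (p : Baire) : p ∈ dec (fun n => p n + 1) := by
  refine ⟨by simpa [dec] using Set.infinite_univ, ?_⟩
  funext k
  simp [dec, Nat.nth_true]

namespace RepSpace

/-- Baire space represented by the identity. -/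
def baire : RepSpace where
  carrier := Baire
  rep := fun p => Part.some p
  surj := fun x => ⟨x, Part.mem_some x⟩

/-- The product `X × Y` with `δ⟨p, q⟩ = (δ_X(p), δ_Y(q))`. -/
def prod (X Y : RepSpace) : RepSpace where
  carrier := X.carrier × Y.carrier
  rep := fun r => (X.rep (fst r)).bind fun x => (Y.rep (snd r)).map fun y => (x, y)
  surj := by
    rintro ⟨x, y⟩
    obtain ⟨p, hp⟩ := X.surj x
    obtain ⟨q, hq⟩ := Y.surj y
    exact ⟨pair p q, by simp [fst_pair, snd_pair, hp, hq]⟩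

/-- The disjoint union `X ⊔ Y` with `δ(0p) = (0, δ_X(p))` and `δ(1p) = (1, δ_Y(p))`. -/
def sum (X Y : RepSpace) : RepSpace where
  carrier := X.carrier ⊕ Y.carrier
  rep := fun r =>
    if r 0 = 0 then (X.rep (tail r)).map Sum.inl
    else if r 0 = 1 then (Y.rep (tail r)).map Sum.inr
    else Part.none
  surj := by
    rintro (x | y)
    · obtain ⟨p, hp⟩ := X.surj x
      exact ⟨cons 0 p, by simpa [tail_cons, cons] using hp⟩
    · obtain ⟨p, hp⟩ := Y.surj y
      exact ⟨cons 1 p, by simpa [tail_cons, cons] using hp⟩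

/-- The countable power `X^ℕ` with `δ⟨p₀, p₁, …⟩ = (δ_X(pₙ))ₙ`. -/
def pow (X : RepSpace) : RepSpace where
  carrier := ℕ → X.carrier
  rep := fun r => ⟨∀ n, (X.rep (proj n r)).Dom, fun h n => (X.rep (proj n r)).get (h n)⟩
  surj := by
    intro x
    choose p hp using fun n => X.surj (x n)
    have hproj : ∀ n, proj n (fun i => p i.unpair.1 i.unpair.2) = p n := by
      intro n; funext k; simp [proj]
    refine ⟨fun i => p i.unpair.1 i.unpair.2, ?_, ?_⟩
    · intro n
      rw [hproj]
      exact Part.dom_iff_mem.2 ⟨_, hp n⟩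
    · funext n
      exact Part.get_eq_of_mem (by rw [hproj]; exact hp n) _

open Classical in
/-- The completion `X ∪ {⊥}` (here `⊥` is `none`) with the total representation that maps `p` to
`δ_X(p - 1)` if this is defined and to `⊥` otherwise. -/
noncomputable def compl (X : RepSpace) : RepSpace where
  carrier := Option X.carrier
  rep := fun p => Part.some ((dec p).bind X.rep).toOption
  surj := by
    rintro (_ | x)
    · refine ⟨fun _ => 0, ?_⟩
      have h : ¬ ((dec fun _ => 0).bind X.rep).Dom := by
        rintro ⟨h, -⟩
        simp [dec] at h
      rw [Part.mem_some_iff, eq_comm]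
      exact Part.toOption_eq_none_iff.2 h
    · obtain ⟨p, hp⟩ := X.surj x
      refine ⟨fun n => p n + 1, ?_⟩
      rw [Part.mem_some_iff, eq_comm]
      exact Part.toOption_eq_some_iff.2 (Part.mem_bind (dec_succ p) hp)

end RepSpace

/-! ### Problems -/

/-- A problem: a partial multi-valued map `f :⊆ X ⇉ Y` between represented spaces. Its domain
consists of the points with a nonempty set of values. -/
structure Problem where
  src : RepSpace
  tgt : RepSpace
  val : src.carrier → Set tgt.carrier

namespace Problem

/-- The domain of a problem. -/
def dom (f : Problem) : Set f.src.carrier := {x | (f.val x).Nonempty}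

/-- `F ⊢ f`: the partial function `F` is a realizer of `f`. -/
def Realizes (F : Baire →. Baire) (f : Problem) : Prop :=
  ∀ p, ∀ x ∈ f.src.rep p, x ∈ f.dom → ∃ q ∈ F p, ∃ y ∈ f.tgt.rep q, y ∈ f.val x

/-- The partial function `H⟨id, GK⟩`. -/
def sandwich (H K G : Baire →. Baire) : Baire →. Baire := fun p =>
  (K p).bind fun k => (G k).bind fun r => H (pair p r)

/-- Weihrauch reducibility. -/
def LeW (f g : Problem) : Prop :=
  ∃ H K : Baire →. Baire, IsComputable H ∧ IsComputable K ∧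
    ∀ G : Baire →. Baire, Realizes G g → Realizes (sandwich H K G) f

/-- The realizer version `δ_Y⁻¹ ∘ f ∘ δ_X :⊆ ℕ^ℕ ⇉ ℕ^ℕ`. -/
def real (f : Problem) (p : Baire) : Set Baire :=
  {q | ∃ x ∈ f.src.rep p, ∃ y ∈ f.tgt.rep q, y ∈ f.val x}

/-- The identity `id : ℕ^ℕ → ℕ^ℕ`; its degree is `1`. -/
def one : Problem where
  src := RepSpace.baire
  tgt := RepSpace.baire
  val := fun p => {q | q = p}

/-- The nowhere defined problem `0 :⊆ ℕ^ℕ → ℕ^ℕ`. -/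
def zero : Problem where
  src := RepSpace.baire
  tgt := RepSpace.baire
  val := fun _ => ∅

/-- The coproduct `f ⊔ g`. -/
def coprod (f g : Problem) : Problem where
  src := f.src.sum g.src
  tgt := f.tgt.sum g.tgt
  val := fun z => match z with
    | Sum.inl x => Sum.inl '' f.val x
    | Sum.inr u => Sum.inr '' g.val u

/-- The meet `f ⊓ g`, with `(f ⊓ g)(x, u) = f(x) ⊔ g(u)` and `dom (f ⊓ g) = dom f × dom g`. -/
def meet (f g : Problem) : Problem where
  src := f.src.prod g.src
  tgt := f.tgt.sum g.tgt
  val := fun z =>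
    {w | z.1 ∈ f.dom ∧ z.2 ∈ g.dom ∧ w ∈ Sum.inl '' f.val z.1 ∪ Sum.inr '' g.val z.2}

/-- The parallelization of `f`. -/
def par (f : Problem) : Problem where
  src := f.src.pow
  tgt := f.tgt.pow
  val := fun x => {y | ∀ n : ℕ, y n ∈ f.val (x n)}

open Classical in
/-- The completion of `f`: it extends `f` to a total problem from the completion of `X` to that of
`Y`, with all values allowed outside `dom f`. -/
noncomputable def compl (f : Problem) : Problem where
  src := f.src.compl
  tgt := f.tgt.compl
  val := fun z => match z with
    | some x => if x ∈ f.dom then some '' f.val x else Set.univ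
    | none => Set.univ

/-- The multiplicative implication `g ↠ f` in the regular case: its values at `p` are the
`⟨n, k, s⟩` such that `∅ ≠ φₙ⟨s, g^r(φₖ(p))⟩ ⊆ f^r(p)`, where the composition of multi-valued
maps is strict, i.e., `φₖ(p)` must be in `dom g^r` and `φₙ⟨s, t⟩` must be defined for all
`t ∈ g^r(φₖ(p))`. -/
def mimpAux (g f : Problem) : Problem where
  src := RepSpace.baire
  tgt := RepSpace.baire
  val := fun p => {w | ∃ (n k : ℕ) (s : Baire), w = cons n (cons k s) ∧
    ∃ r ∈ phi k p, (g.real r).Nonempty ∧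
      ∀ t ∈ g.real r, ∃ v ∈ phi n (pair s t), v ∈ f.real p}

/-- The constant problem `ℕ^ℕ ⇉ ℕ^ℕ` with value `A`. -/
def const (A : Set Baire) : Problem where
  src := RepSpace.baire
  tgt := RepSpace.baire
  val := fun _ => A

end Problem

/-- Problems including the additional top element `∞`. -/
inductive ExtProblem where
  | of (f : Problem) : ExtProblem
  | infty : ExtProblem

namespace ExtProblem

/-- Weihrauch reducibility with `∞` as an additional top element. -/
def LeW : ExtProblem → ExtProblem → Prop
  | _, infty => True
  | infty, of _ => False
  | of f, of g => f.LeW g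

/-- The coproduct, with `f ⊔ ∞ = ∞ ⊔ f = ∞`. -/
def coprod : ExtProblem → ExtProblem → ExtProblem
  | of f, of g => of (f.coprod g)
  | infty, _ => infty
  | of _, infty => infty

/-- The meet, with `f ⊓ ∞ = ∞ ⊓ f = f`. -/
def meet : ExtProblem → ExtProblem → ExtProblem
  | of f, of g => of (f.meet g)
  | infty, g => g
  | of f, infty => of f

/-- Completion followed by parallelization, with value `∞` at `∞`. -/
noncomputable def parCompl : ExtProblem → ExtProblem
  | of f => of f.compl.par
  | infty => infty

open Classical in
/-- The multiplicative implication `g ↠ f`, with `(∞ ↠ f) = 0`, `(g ↠ ∞) = ∞` for `g ≠ ∞`, and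
`(g ↠ f) = ∞` if `g` is nowhere defined and `f` is not. (If `f` is nowhere defined, then so is
`mimpAux g f`.) -/
noncomputable def mimp : ExtProblem → ExtProblem → ExtProblem
  | infty, _ => of Problem.zero
  | of _, infty => infty
  | of g, of f => if g.dom = ∅ ∧ f.dom ≠ ∅ then infty else of (Problem.mimpAux g f)

/-- Parallelized total Weihrauch reducibility: `f` is Weihrauch reducible to the parallelized
completion of `g`. -/
def LePtW (f g : ExtProblem) : Prop := LeW f (parCompl g)

/-- The parallelized completion of the meet operation. -/
noncomputable def ptMeet (f g : ExtProblem) : ExtProblem := meet (parCompl f) (parCompl g)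

/-- The parallelized completion `g ⇛ f` of the multiplicative implication. -/
noncomputable def ptImp (g f : ExtProblem) : ExtProblem := mimp (parCompl g) (parCompl f)

end ExtProblem

/-! ### Mass problems -/

/-- Medvedev reducibility. -/
def LeM (A B : Set Baire) : Prop :=
  ∃ F : Baire →. Baire, IsComputable F ∧ ∀ p ∈ B, ∃ q ∈ F p, q ∈ A

/-- `A ⊗ B = 0A ∪ 1B`. -/
def otimes (A B : Set Baire) : Set Baire := cons 0 '' A ∪ cons 1 '' B

/-- `A ⊕ B = ⟨A × B⟩`. -/
def oplus (A B : Set Baire) : Set Baire := {r | ∃ p ∈ A, ∃ q ∈ B, r = pair p q}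

/-- `B → A`, the set of all `⟨n, q⟩` such that `φₙ⟨q, p⟩ ∈ A` for all `p ∈ B`. -/
def impM (B A : Set Baire) : Set Baire :=
  {r | ∃ (n : ℕ) (q : Baire), r = cons n q ∧ ∀ p ∈ B, ∃ v ∈ phi n (pair q p), v ∈ A}

open Classical in
/-- `c_A`: the constant problem with value `A`, and `c_∅ = ∞`. -/
noncomputable def cProblem (A : Set Baire) : ExtProblem :=
  if A = ∅ then ExtProblem.infty else ExtProblem.of (Problem.const A)

/-! ### Degrees -/

/-- The Medvedev degrees: mass problems modulo mutual reducibility. -/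
def MedvedevDegree : Type := Quot fun A B : Set Baire => LeM A B ∧ LeM B A

/-- The Medvedev degree of `A`. -/
def MedvedevDegree.mk (A : Set Baire) : MedvedevDegree := Quot.mk _ A

/-- The parallelized total Weihrauch degrees including `∞`: problems modulo mutual reducibility. -/
def PtWDegree : Type 1 := Quot fun f g : ExtProblem => f.LePtW g ∧ g.LePtW f

/-- The parallelized total Weihrauch degree of `f`. -/
def PtWDegree.mk (f : ExtProblem) : PtWDegree := Quot.mk _ f

/-- A Brouwer algebra, i.e., a co-Heyting algebra, on the Medvedev degrees is the standard one: its
order and its operations are induced by those on mass problems. In a co-Heyting algebra `a \ b` is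
the least `c` with `a ≤ b ⊔ c`, that is, the Brouwer implication from `b` to `a`. -/
structure IsMedvedevAlgebra (M : CoheytingAlgebra MedvedevDegree) : Prop where
  le_iff : ∀ A B, MedvedevDegree.mk A ≤ MedvedevDegree.mk B ↔ LeM A B
  inf_eq : ∀ A B, MedvedevDegree.mk A ⊓ MedvedevDegree.mk B = MedvedevDegree.mk (otimes A B)
  sup_eq : ∀ A B, MedvedevDegree.mk A ⊔ MedvedevDegree.mk B = MedvedevDegree.mk (oplus A B)
  imp_eq : ∀ A B, MedvedevDegree.mk A \ MedvedevDegree.mk B = MedvedevDegree.mk (impM B A)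
  bot_eq : ⊥ = MedvedevDegree.mk Set.univ
  top_eq : ⊤ = MedvedevDegree.mk ∅

/-- A Brouwer algebra on the parallelized total Weihrauch degrees is the standard one: its order and
its operations are induced by those on problems. -/
structure IsPtWAlgebra (W : CoheytingAlgebra PtWDegree) : Prop where
  le_iff : ∀ f g, PtWDegree.mk f ≤ PtWDegree.mk g ↔ f.LePtW g
  inf_eq : ∀ f g, PtWDegree.mk f ⊓ PtWDegree.mk g = PtWDegree.mk (f.ptMeet g)
  sup_eq : ∀ f g, PtWDegree.mk f ⊔ PtWDegree.mk g = PtWDegree.mk (f.coprod g)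
  imp_eq : ∀ f g, PtWDegree.mk f \ PtWDegree.mk g = PtWDegree.mk (g.ptImp f)
  bot_eq : ⊥ = PtWDegree.mk (ExtProblem.of Problem.one)
  top_eq : ⊤ = PtWDegree.mk ExtProblem.infty

end MedvedevWeihrauch

open MedvedevWeihrauch

namespace MedvedevWeihrauch

/-! ### Computable functions on Baire space -/

/-! Both reducibilities are preorders, and both quotients become Brouwer algebras once the
residuation law `sdiff a b ≤ c ↔ a ≤ sup b c` holds (`BrouwerPreorder`). For mass problems this law
is currying (`impM_leM_iff`). For problems it rests on two effects of passing to the parallelized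
completion `total`.

Completion makes partial queries harmless: a computable partial function can be evaluated by a total
one that writes zeros while it waits, so a diverging computation becomes a name of `⊥`
(`IsComputable.exists_padding`). Parallelization allows countably many queries at once. Hence
`total` acts as a closure operator (`Problem.LeW.total`). It also removes the apparent adaptivity of
`↠`: the value `⟨n, k, s⟩` is known only after `h` has been answered, but the queries `φₖ(p)` for
all `k` can be posed in advance (`Problem.leW_coprod_of_mimpAux_leW`).

For constant problems the input carries no information. A reduction of `c_A` to the parallelized
completion of `c_B` may therefore be run on the zero sequence, and every `b ∈ B`, repeated in all
components, is a legitimate answer; this is a Medvedev reduction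
(`Problem.const_leW_total_const_iff`). For meets, joins and implications, one inequality then
follows from the order embedding and the universal properties. The others are
`ptMeet_cProblem_lePtW`, `cProblem_oplus_lePtW` and `cProblem_impM_lePtW`. -/

theorem length_initSeg (p : Baire) (j : ℕ) : (initSeg p j).length = j := by simp [initSeg]

theorem getElem?_initSeg (p : Baire) (j i : ℕ) :
    (initSeg p j)[i]? = if i < j then some (p i) else none := by
  split_ifs with h <;> simp [initSeg, h]

theorem take_initSeg (p : Baire) {i j : ℕ} (h : i ≤ j) :
    (initSeg p j).take i = initSeg p i := by
  simp [initSeg, ← List.map_take, List.take_range, h]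

theorem initSeg_succ (p : Baire) (j : ℕ) : initSeg p (j + 1) = p 0 :: initSeg (tail p) j := by
  simp [initSeg, List.range_succ_eq_map, tail, Function.comp_def]

theorem initSeg_concat (p : Baire) (j : ℕ) : initSeg p (j + 1) = initSeg p j ++ [p j] := by
  simp [initSeg, List.range_succ]

/-- The first value among `f 0, …, f (k - 1)`. -/
def firstSome (f : ℕ → Option ℕ) (k : ℕ) : Option ℕ :=
  Nat.rec none (fun i r => r <|> f i) k

theorem firstSome_succ (f : ℕ → Option ℕ) (k : ℕ) :
    firstSome f (k + 1) = (firstSome f k <|> f k) := rfl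

theorem primrec_firstSome {α : Type*} [Primcodable α] {f : α → ℕ → Option ℕ} {k : α → ℕ}
    (hf : Primrec₂ f) (hk : Primrec k) : Primrec fun a => firstSome (f a) (k a) :=
  Primrec.nat_rec' (g := fun _ => none) (h := fun a x => x.2 <|> f a x.1) hk (Primrec.const none)
    (.mk (Primrec.option_orElse.comp (Primrec.snd.comp Primrec.snd)
      (hf.comp Primrec.fst (Primrec.fst.comp Primrec.snd))))

theorem firstSome_mono {f : ℕ → Option ℕ} {k k' v : ℕ} (hk : k ≤ k')
    (h : firstSome f k = some v) : firstSome f k' = some v := by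
  induction hk with
  | refl => exact h
  | step _ ih => simp [firstSome_succ, ih]

theorem firstSome_congr {f f' : ℕ → Option ℕ} {k : ℕ} (h : ∀ i < k, f i = f' i) :
    firstSome f k = firstSome f' k := by
  induction k with
  | zero => rfl
  | succ k ih =>
    rw [firstSome_succ, firstSome_succ, ih fun i hi => h i (hi.trans k.lt_succ_self),
      h k k.lt_succ_self]

theorem exists_of_firstSome {f : ℕ → Option ℕ} {k v : ℕ} (h : firstSome f k = some v) :
    ∃ i < k, f i = some v := by
  induction k with
  | zero => simp [firstSome] at h
  | succ k ih =>
    have h : (firstSome f k).or (f k) = some v := by simpa [firstSome_succ] using h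
    rw [Option.or_eq_some_iff] at h
    rcases h with h | ⟨-, h⟩
    · obtain ⟨i, hi, h⟩ := ih h
      exact ⟨i, hi.trans k.lt_succ_self, h⟩
    · exact ⟨k, k.lt_succ_self, h⟩

/-- Bounded searches are monotone in the bound, so the unbounded search is their limit. This yields
finite approximations of `phiVal` whose results persist. -/
theorem mem_rfindOpt_iff {f : ℕ → Option ℕ} {v : ℕ} :
    v ∈ Nat.rfindOpt f ↔ ∃ k, firstSome f k = some v := by
  have key : ∀ v ∈ Nat.rfindOpt f, ∃ k, firstSome f k = some v := by
    intro v hv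
    obtain ⟨n, hn, hv⟩ := Part.mem_bind_iff.1 hv
    have hlt : ∀ {m}, m < n → false ∈ ((f m).isSome : Part Bool) := (Nat.mem_rfind.1 hn).2
    refine ⟨n + 1, ?_⟩
    have hnone : firstSome f n = none := by
      rw [Option.eq_none_iff_forall_ne_some]
      intro w hw
      obtain ⟨i, hi, h⟩ := exists_of_firstSome hw
      simpa [h] using hlt hi
    rw [firstSome_succ, hnone]
    simpa using hv
  refine ⟨key v, ?_⟩
  rintro ⟨k, hk⟩
  obtain ⟨i, -, hi⟩ := exists_of_firstSome hk
  have hd : (Nat.rfindOpt f).Dom := Nat.rfindOpt_dom.2 ⟨i, v, hi⟩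
  obtain ⟨k', hk'⟩ := key _ (Part.get_mem hd)
  have h1 := firstSome_mono (le_max_left k k') hk
  rw [firstSome_mono (le_max_right k k') hk'] at h1
  rw [← Option.some_inj.1 h1]
  exact Part.get_mem hd

/-- The `n`-th program for the position `m`, run on prefixes of the list `l`. -/
def evalPrefix (n : ℕ) (l : List ℕ) (m : ℕ) : Option ℕ :=
  firstSome (fun i => Nat.Partrec.Code.evaln i.unpair.2 (Denumerable.ofNat Nat.Partrec.Code n)
    (Nat.pair (Encodable.encode (l.take i.unpair.1)) m)) l.length

theorem primrec_evalPrefix :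
    Primrec fun x : ℕ × List ℕ × ℕ => evalPrefix x.1 x.2.1 x.2.2 := by
  refine primrec_firstSome (.mk ?_) (Primrec.list_length.comp (Primrec.fst.comp Primrec.snd))
  have hi : Primrec fun x : (ℕ × List ℕ × ℕ) × ℕ => x.2.unpair :=
    Primrec.unpair.comp Primrec.snd
  refine Nat.Partrec.Code.primrec_evaln.comp (Primrec.pair (Primrec.pair (Primrec.snd.comp hi)
    ((Primrec.ofNat _).comp (Primrec.fst.comp Primrec.fst))) ?_)
  refine Primrec₂.natPair.comp (Primrec.encode.comp (Primrec.list_take.comp (Primrec.fst.comp hi)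
    (Primrec.fst.comp (Primrec.snd.comp Primrec.fst))))
    (Primrec.snd.comp (Primrec.snd.comp Primrec.fst))

theorem primrec_evalPrefix_comp {α : Type*} [Primcodable α] {f : α → ℕ} {g : α → List ℕ}
    {h : α → ℕ} (hf : Primrec f) (hg : Primrec g) (hh : Primrec h) :
    Primrec fun a => evalPrefix (f a) (g a) (h a) :=
  primrec_evalPrefix.comp (hf.pair (hg.pair hh))

theorem evalPrefix_initSeg (n : ℕ) (p : Baire) (j m : ℕ) :
    evalPrefix n (initSeg p j) m = firstSome (fun i =>
      Nat.Partrec.Code.evaln i.unpair.2 (Denumerable.ofNat Nat.Partrec.Code n)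
        (Nat.pair (Encodable.encode (initSeg p i.unpair.1)) m)) j := by
  rw [evalPrefix, length_initSeg]
  refine firstSome_congr fun i hi => ?_
  -- The first component of `i.unpair` is at most `i < j`, so truncation only ever asks for prefixes
  -- that are present.
  rw [take_initSeg p ((Nat.unpair_left_le i).trans hi.le)]

theorem mem_phiVal {n : ℕ} {p : Baire} {m v : ℕ} :
    v ∈ phiVal n p m ↔ ∃ j, evalPrefix n (initSeg p j) m = some v := by
  simp only [evalPrefix_initSeg]
  exact mem_rfindOpt_iff

theorem evalPrefix_mono {n : ℕ} {p : Baire} {j j' m v : ℕ} (h : j ≤ j')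
    (hv : evalPrefix n (initSeg p j) m = some v) : evalPrefix n (initSeg p j') m = some v := by
  rw [evalPrefix_initSeg] at hv ⊢
  exact firstSome_mono h hv

theorem mem_phi {n : ℕ} {p q : Baire} : q ∈ phi n p ↔ ∀ m, q m ∈ phiVal n p m := by
  constructor
  · rintro ⟨h, rfl⟩ m
    exact Part.get_mem (h m)
  · intro h
    exact ⟨fun m => Part.dom_iff_mem.2 ⟨_, h m⟩, funext fun m => Part.get_eq_of_mem (h m) (Part.dom_iff_mem.2 ⟨_, h m⟩)⟩

theorem exists_evalPrefix {n : ℕ} {p q : Baire} (h : q ∈ phi n p) (m : ℕ) :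
    ∃ j, evalPrefix n (initSeg p j) m = some (q m) := mem_phiVal.1 (mem_phi.1 h m)

theorem eq_of_evalPrefix {n : ℕ} {p q : Baire} (h : q ∈ phi n p) {m j v : ℕ}
    (hv : evalPrefix n (initSeg p j) m = some v) : v = q m :=
  Part.mem_unique (mem_phiVal.2 ⟨j, hv⟩) (mem_phi.1 h m)

/-- The working criterion for computability: some prefix yields an answer, and no prefix yields a
wrong one. Since `g` answers in `Option`, it can be taken total and usually primitive recursive. -/
theorem isComputable_of_option {F : Baire →. Baire} (g : List ℕ × ℕ → Option ℕ)
    (hg : Computable g)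
    (hF : ∀ p q, q ∈ F p → ∀ m, (∃ j, g (initSeg p j, m) = some (q m)) ∧
      ∀ j v, g (initSeg p j, m) = some v → v = q m) : IsComputable F := by
  refine ⟨fun x => (g x : Part ℕ), hg.ofOption, fun p q hq m v => ?_⟩
  obtain ⟨h1, h2⟩ := hF p q hq m
  constructor
  · rintro rfl
    simpa using h1
  · rintro ⟨j, hj⟩
    exact (h2 j v (by simpa using hj)).symm

/-- A function is computable if and only if some `φₙ` extends it. -/
theorem isComputable_iff {F : Baire →. Baire} :
    IsComputable F ↔ ∃ n, ∀ p, ∀ q ∈ F p, q ∈ phi n p := by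
  constructor
  · rintro ⟨g, hg, hF⟩
    obtain ⟨c, hc⟩ := Nat.Partrec.Code.exists_code.1 hg
    refine ⟨Encodable.encode c, fun p q hq => mem_phi.2 fun m => ?_⟩
    have hev : ∀ (l : List ℕ) (m v : ℕ), v ∈ g (l, m) ↔
        v ∈ c.eval (Nat.pair (Encodable.encode l) m) := by
      intro l m v
      have h1 : Nat.pair (Encodable.encode l) m = Encodable.encode (l, m) := rfl
      rw [hc, h1]
      simp
    simp only [phiVal, Denumerable.ofNat_encode]
    -- The dovetailed search may stop at any index, so every result it can meet has to be correct,
    -- not just the first expected one.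
    have hsound : ∀ (i v : ℕ), Nat.Partrec.Code.evaln i.unpair.2 c
        (Nat.pair (Encodable.encode (initSeg p i.unpair.1)) m) = some v → v = q m := by
      intro i v hv
      refine ((hF p q hq m v).2 ⟨_, (hev _ _ _).2 (Nat.Partrec.Code.evaln_sound hv)⟩).symm
    obtain ⟨j, hj⟩ := (hF p q hq m (q m)).1 rfl
    obtain ⟨k, hk⟩ := Nat.Partrec.Code.evaln_complete.1 ((hev _ _ _).1 hj)
    have hd := (Nat.rfindOpt_dom (f := fun i : ℕ => Nat.Partrec.Code.evaln i.unpair.2 c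
        (Nat.pair (Encodable.encode (initSeg p i.unpair.1)) m))).2
      ⟨Nat.pair j k, q m, by simpa using hk⟩
    obtain ⟨i, hi⟩ := Nat.rfindOpt_spec (Part.get_mem hd)
    rw [← hsound i _ hi]
    exact Part.get_mem hd
  · rintro ⟨n, hn⟩
    refine isComputable_of_option (fun x => evalPrefix n x.1 x.2)
      (primrec_evalPrefix_comp (Primrec.const n) Primrec.fst Primrec.snd).to_comp ?_
    intro p q hq m
    exact ⟨exists_evalPrefix (hn p q hq) m, fun j v hv => eq_of_evalPrefix (hn p q hq) hv⟩

/-- Nothing is required off the domain, so restrictions stay computable. Closure properties can thus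
be proved for whichever extension is convenient. -/
theorem IsComputable.mono {F G : Baire →. Baire} (hG : IsComputable G)
    (h : ∀ p, ∀ q ∈ F p, q ∈ G p) : IsComputable F := by
  obtain ⟨n, hn⟩ := isComputable_iff.1 hG
  exact isComputable_iff.2 ⟨n, fun p q hq => hn p q (h p q hq)⟩

/-- The values of `f` at `0, …, k - 1`, if all of them exist. -/
def collect (f : ℕ → Option ℕ) (k : ℕ) : Option (List ℕ) :=
  Nat.rec (some []) (fun i r => r.bind fun l => (f i).map fun v => l ++ [v]) k

theorem primrec_collect {α : Type*} [Primcodable α] {f : α → ℕ → Option ℕ} {k : α → ℕ}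
    (hf : Primrec₂ f) (hk : Primrec k) : Primrec fun a => collect (f a) (k a) :=
  Primrec.nat_rec' (g := fun _ => some [])
    (h := fun a x => x.2.bind fun l => (f a x.1).map fun v => l ++ [v]) hk
    (Primrec.const (some []))
    (.mk (Primrec.option_bind (Primrec.snd.comp Primrec.snd)
      (.mk (Primrec.option_map (hf.comp (Primrec.fst.comp Primrec.fst)
        (Primrec.fst.comp (Primrec.snd.comp Primrec.fst)))
        (.mk (Primrec.list_concat.comp (Primrec.snd.comp Primrec.fst) Primrec.snd))))))

theorem collect_eq_some {f : ℕ → Option ℕ} {q : Baire} {k : ℕ} (h : ∀ i < k, f i = some (q i)) :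
    collect f k = some (initSeg q k) := by
  induction k with
  | zero => rfl
  | succ k ih =>
    have : collect f (k + 1) = (collect f k).bind fun l => (f k).map fun v => l ++ [v] := rfl
    rw [this, ih fun i hi => h i (hi.trans k.lt_succ_self), h k k.lt_succ_self, initSeg_concat]
    rfl

theorem collect_sound {f : ℕ → Option ℕ} {q : Baire} (h : ∀ i v, f i = some v → v = q i)
    {k : ℕ} {l : List ℕ} (hl : collect f k = some l) : l = initSeg q k := by
  induction k generalizing l with
  | zero => simpa [collect, initSeg, eq_comm] using hl
  | succ k ih =>
    have : collect f (k + 1) = (collect f k).bind fun l => (f k).map fun v => l ++ [v] := rfl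
    rw [this, Option.bind_eq_some_iff] at hl
    obtain ⟨l', hl', hl⟩ := hl
    obtain ⟨v, hv, rfl⟩ := Option.map_eq_some_iff.1 hl
    rw [ih hl', h k v hv, initSeg_concat]

theorem IsComputable.bind_const {F G : Baire →. Baire} (hF : IsComputable F)
    (hG : IsComputable G) : IsComputable fun p => (F p).bind G := by
  obtain ⟨a, ha⟩ := isComputable_iff.1 hF
  obtain ⟨b, hb⟩ := isComputable_iff.1 hG
  refine isComputable_of_option (fun x => (collect (fun i => evalPrefix a x.1 i)
    x.1.length.unpair.1).bind fun l => evalPrefix b l x.2) ?_ ?_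
  · refine Primrec.to_comp (Primrec.option_bind ?_ (.mk ?_))
    · exact primrec_collect (.mk (primrec_evalPrefix_comp (Primrec.const a)
        (Primrec.fst.comp Primrec.fst) Primrec.snd))
        (Primrec.fst.comp (Primrec.unpair.comp (Primrec.list_length.comp Primrec.fst)))
    · exact primrec_evalPrefix_comp (Primrec.const b) Primrec.snd (Primrec.snd.comp Primrec.fst)
  · intro p r hr m
    obtain ⟨q, hq, hr⟩ := Part.mem_bind_iff.1 hr
    have hq := ha p q hq
    have hr := hb q r hr
    constructor
    · obtain ⟨k, hk⟩ := exists_evalPrefix hr m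
      have : ∃ j, ∀ i < k, evalPrefix a (initSeg p j) i = some (q i) := by
        choose J hJ using exists_evalPrefix hq
        exact ⟨(Finset.range k).sup J, fun i hi =>
          evalPrefix_mono (Finset.le_sup (Finset.mem_range.2 hi)) (hJ i)⟩
      obtain ⟨j, hj⟩ := this
      -- The length of the prefix codes both bounds: its first component `k` says how many
      -- intermediate values to pass on, and the length itself is at least `j`, which suffices to
      -- compute them.
      refine ⟨Nat.pair k j, ?_⟩
      have := collect_eq_some (f := fun i => evalPrefix a (initSeg p (Nat.pair k j)) i)
        fun i hi => evalPrefix_mono (Nat.right_le_pair k j) (hj i hi)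
      simp only [length_initSeg, Nat.unpair_pair, this]
      exact hk
    · intro j v hv
      simp only [Option.bind_eq_some_iff] at hv
      obtain ⟨l, hl, hv⟩ := hv
      rw [collect_sound (q := q) (fun i v hv => eq_of_evalPrefix hq hv) hl] at hv
      exact eq_of_evalPrefix hr hv

/-- A total function is computable. -/
def TComp (f : Baire → Baire) : Prop := IsComputable fun p => Part.some (f p)

theorem IsComputable.comp {F : Baire →. Baire} {f : Baire → Baire} (hF : IsComputable F)
    (hf : TComp f) : IsComputable fun p => F (f p) :=
  (hf.bind_const hF).mono fun _ _ hq => 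
    Part.mem_bind (Part.mem_some _) hq

theorem TComp.comp {f g : Baire → Baire} (hf : TComp f) (hg : TComp g) :
    TComp fun p => f (g p) := IsComputable.comp (F := fun p => Part.some (f p)) hf hg

/-! ### Total computable functions and closure properties -/

theorem pair_apply (p q : Baire) (m : ℕ) :
    pair p q m = bif Nat.bodd m then q m.div2 else p m.div2 := by
  rw [pair, Nat.div2_val, Nat.mod_two_of_bodd]
  cases Nat.bodd m <;> simp

theorem IsComputable.pair {F G : Baire →. Baire} (hF : IsComputable F) (hG : IsComputable G) :
    IsComputable fun p => (F p).bind fun q => (G p).map fun r => pair q r := by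
  obtain ⟨a, ha⟩ := isComputable_iff.1 hF
  obtain ⟨b, hb⟩ := isComputable_iff.1 hG
  refine isComputable_of_option (fun x => evalPrefix (bif Nat.bodd x.2 then b else a) x.1 x.2.div2)
    (primrec_evalPrefix_comp (Primrec.cond (Primrec.nat_bodd.comp Primrec.snd)
      (Primrec.const b) (Primrec.const a)) Primrec.fst
      (Primrec.nat_div2.comp Primrec.snd)).to_comp ?_
  intro p v hv m
  simp only [Part.mem_bind_iff, Part.mem_map_iff] at hv
  obtain ⟨q, hq, r, hr, rfl⟩ := hv
  simp only [pair_apply]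
  cases Nat.bodd m
  · exact ⟨exists_evalPrefix (ha p q hq) _, fun j v => eq_of_evalPrefix (ha p q hq)⟩
  · exact ⟨exists_evalPrefix (hb p r hr) _, fun j v => eq_of_evalPrefix (hb p r hr)⟩

theorem TComp.pair {f g : Baire → Baire} (hf : TComp f) (hg : TComp g) :
    TComp fun p => pair (f p) (g p) :=
  (IsComputable.pair hf hg).mono fun p q hq => by simpa using hq

/-- Covers all rearrangements of sequences needed below: an output entry uses one input entry at a
computed position. The entry `v 0` is available as well, to serve as a numerical parameter. -/
theorem TComp.of_lookup {f : Baire → Baire} {e : ℕ × ℕ → ℕ} {h : ℕ × ℕ × ℕ → ℕ}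
    (he : Computable e) (hh : Computable h)
    (H : ∀ v m, f v m = h (m, v 0, v (e (m, v 0)))) : TComp f := by
  refine isComputable_of_option (fun x => x.1[0]?.bind fun n => (x.1[e (x.2, n)]?).map fun w =>
    h (x.2, n, w)) ?_ ?_
  · refine Computable.option_bind (Computable.list_getElem?.comp Computable.fst
      (Computable.const 0)) (Computable.option_map ?_ ?_)
    · exact Computable.list_getElem?.comp (Computable.fst.comp Computable.fst)
        (he.comp (Computable.pair (Computable.snd.comp Computable.fst) Computable.snd))
    · exact hh.comp (Computable.pair (Computable.snd.comp (Computable.fst.comp Computable.fst))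
        (Computable.pair (Computable.snd.comp Computable.fst) Computable.snd))
  · intro p q hq m
    obtain rfl := Part.mem_some_iff.1 hq
    constructor
    -- This prefix is just long enough to show position `e (m, p 0)`, and it is nonempty, so that `p
    -- 0` is visible too.
    · refine ⟨e (m, p 0) + 1, ?_⟩
      simp [getElem?_initSeg, H]
    · intro j v hv
      simp only [Option.bind_eq_some_iff, Option.map_eq_some_iff, getElem?_initSeg] at hv
      obtain ⟨n, hn, w, hw, rfl⟩ := hv
      have hn : p 0 = n := by split_ifs at hn; simpa using hn
      subst hn
      have hw : p (e (m, p 0)) = w := by split_ifs at hw; simpa using hw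
      rw [H, hw]

theorem TComp.id : TComp fun p => p :=
  .of_lookup (e := fun x => x.1) (h := fun x => x.2.2) Computable.fst
    (Computable.snd.comp Computable.snd) fun _ _ => rfl

theorem tComp_fst : TComp fst :=
  .of_lookup (e := fun x => 2 * x.1) (h := fun x => x.2.2)
    (Primrec.nat_mul.comp (Primrec.const 2) Primrec.fst).to_comp
    (Computable.snd.comp Computable.snd) fun _ _ => rfl

theorem tComp_snd : TComp snd :=
  .of_lookup (e := fun x => 2 * x.1 + 1) (h := fun x => x.2.2)
    (Primrec.succ.comp (Primrec.nat_mul.comp (Primrec.const 2) Primrec.fst)).to_comp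
    (Computable.snd.comp Computable.snd) fun _ _ => rfl

theorem tComp_tail : TComp tail :=
  .of_lookup (e := fun x => x.1 + 1) (h := fun x => x.2.2)
    (Primrec.succ.comp Primrec.fst).to_comp (Computable.snd.comp Computable.snd) fun _ _ => rfl

theorem tComp_succ : TComp fun p n => p n + 1 :=
  .of_lookup (e := fun x => x.1) (h := fun x => x.2.2 + 1) Computable.fst
    (Primrec.succ.comp (Primrec.snd.comp Primrec.snd)).to_comp fun _ _ => rfl

theorem tComp_const (n : ℕ) : TComp fun _ _ => n :=
  .of_lookup (e := fun x => x.1) (h := fun _ => n) Computable.fst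
    (Computable.const n) fun _ _ => rfl

/-- The sequence all of whose projections are `p`. -/
def replicate (p : Baire) : Baire := fun i => p i.unpair.2

theorem proj_replicate (n : ℕ) (p : Baire) : proj n (replicate p) = p := by
  funext k; simp [proj, replicate]

theorem tComp_replicate : TComp replicate :=
  .of_lookup (e := fun x => x.1.unpair.2) (h := fun x => x.2.2)
    (Primrec.snd.comp (Primrec.unpair.comp Primrec.fst)).to_comp
    (Computable.snd.comp Computable.snd) fun _ _ => rfl

theorem TComp.fst {f : Baire → Baire} (hf : TComp f) : TComp fun p => fst (f p) :=
  tComp_fst.comp hf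

theorem TComp.snd {f : Baire → Baire} (hf : TComp f) : TComp fun p => snd (f p) :=
  tComp_snd.comp hf

theorem TComp.tail {f : Baire → Baire} (hf : TComp f) : TComp fun p => tail (f p) :=
  tComp_tail.comp hf

theorem TComp.succ {f : Baire → Baire} (hf : TComp f) : TComp fun p n => f p n + 1 :=
  tComp_succ.comp hf

theorem TComp.replicate {f : Baire → Baire} (hf : TComp f) : TComp fun p => replicate (f p) :=
  tComp_replicate.comp hf

/-- `N` is a total computable function from Baire space to the natural numbers. -/
def NComp (N : Baire → ℕ) : Prop := TComp fun p _ => N p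

theorem NComp.const (n : ℕ) : NComp fun _ => n := tComp_const n

theorem TComp.apply {f : Baire → Baire} (hf : TComp f) (k : ℕ) : NComp fun p => f p k :=
  TComp.comp (f := fun p _ => p k) (.of_lookup (e := fun _ => k) (h := fun x => x.2.2)
    (Computable.const k) (Computable.snd.comp Computable.snd) fun _ _ => rfl) hf

theorem NComp.map {N : Baire → ℕ} (hN : NComp N) {e : ℕ → ℕ} (he : Computable e) :
    NComp fun p => e (N p) :=
  TComp.comp (f := fun p m => e (p m)) (.of_lookup (e := fun x => x.1) (h := fun x => e x.2.2)
    Computable.fst (he.comp (Computable.snd.comp Computable.snd)) fun _ _ => rfl) hN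

theorem NComp.unpair_fst {N : Baire → ℕ} (hN : NComp N) : NComp fun p => (N p).unpair.1 :=
  hN.map (Primrec.fst.comp Primrec.unpair).to_comp

theorem NComp.unpair_snd {N : Baire → ℕ} (hN : NComp N) : NComp fun p => (N p).unpair.2 :=
  hN.map (Primrec.snd.comp Primrec.unpair).to_comp

theorem cons_zero (n : ℕ) (p : Baire) : cons n p 0 = n := rfl

theorem pair_zero (p q : Baire) : pair p q 0 = p 0 := rfl

theorem TComp.cons {N : Baire → ℕ} {f : Baire → Baire} (hN : NComp N) (hf : TComp f) :
    TComp fun p => cons (N p) (f p) := by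
  have : TComp fun w => MedvedevWeihrauch.cons (w 0) (MedvedevWeihrauch.snd w) := by
    -- The number is supplied as a constant sequence in the first half of the pair. At `m = 0` the
    -- truncated subtraction yields a dummy position, whose entry is discarded.
    refine .of_lookup (e := fun x => 2 * (x.1 - 1) + 1)
      (h := fun x => bif x.1 == 0 then x.2.1 else x.2.2)
      (Primrec.succ.comp (Primrec.nat_mul.comp (Primrec.const 2)
        (Primrec.pred.comp Primrec.fst))).to_comp
      (Primrec.cond (Primrec.beq.comp Primrec.fst (Primrec.const 0))
        (Primrec.fst.comp Primrec.snd) (Primrec.snd.comp Primrec.snd)).to_comp ?_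
    rintro v (_ | m) <;> rfl
  refine (this.comp (TComp.pair hN hf)).mono fun p q hq => ?_
  simpa [pair_zero, snd_pair] using hq

theorem TComp.proj {N : Baire → ℕ} {f : Baire → Baire} (hN : NComp N) (hf : TComp f) :
    TComp fun p => proj (N p) (f p) := by
  have : TComp fun w => MedvedevWeihrauch.proj (w 0) (MedvedevWeihrauch.snd w) :=
    .of_lookup (e := fun x => 2 * Nat.pair x.2 x.1 + 1) (h := fun x => x.2.2)
      (Primrec.succ.comp (Primrec.nat_mul.comp (Primrec.const 2)
        (Primrec₂.natPair.comp Primrec.snd Primrec.fst))).to_comp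
      (Computable.snd.comp Computable.snd) fun _ _ => rfl
  refine (this.comp (TComp.pair hN hf)).mono fun p q hq => ?_
  simpa [pair_zero, snd_pair] using hq

/-- The `n`-th subsequence of a sequence that is indexed by pairs. -/
def row (n : ℕ) (t : Baire) : Baire := fun i =>
  t (Nat.pair (Nat.pair n i.unpair.1) i.unpair.2)

theorem proj_row (i n : ℕ) (t : Baire) : proj i (row n t) = proj (Nat.pair n i) t := by
  funext k; simp [proj, row]

theorem TComp.row {N : Baire → ℕ} {f : Baire → Baire} (hN : NComp N) (hf : TComp f) :
    TComp fun p => row (N p) (f p) := by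
  have : TComp fun w => MedvedevWeihrauch.row (w 0) (MedvedevWeihrauch.snd w) :=
    .of_lookup (e := fun x =>
        2 * Nat.pair (Nat.pair x.2 x.1.unpair.1) x.1.unpair.2 + 1) (h := fun x => x.2.2)
      (Primrec.succ.comp (Primrec.nat_mul.comp (Primrec.const 2)
        (Primrec₂.natPair.comp (Primrec₂.natPair.comp Primrec.snd
          (Primrec.fst.comp (Primrec.unpair.comp Primrec.fst)))
          (Primrec.snd.comp (Primrec.unpair.comp Primrec.fst))))).to_comp
      (Computable.snd.comp Computable.snd) fun _ _ => rfl
  refine (this.comp (TComp.pair hN hf)).mono fun p q hq => ?_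
  simpa [pair_zero, snd_pair] using hq

/-- Unlike `bind_const`, the second stage still sees the original input; it is handed on inside a
pair. -/
theorem IsComputable.bind {F : Baire →. Baire} {G : Baire → Baire →. Baire}
    (hF : IsComputable F) (hG : IsComputable fun v => G (fst v) (snd v)) :
    IsComputable fun p => (F p).bind fun q => G p q := by
  refine ((IsComputable.pair TComp.id hF).bind_const hG).mono fun p r hr => ?_
  simp only [Part.mem_bind_iff] at hr
  obtain ⟨q, hq, hr⟩ := hr
  simp only [Part.mem_bind_iff, Part.mem_map_iff, Part.mem_some_iff]
  exact ⟨_, ⟨_, rfl, q, hq, rfl⟩, by simpa [fst_pair, snd_pair] using hr⟩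

/-- The `φₙ` are uniformly computable in `n`. -/
theorem isComputable_universal : IsComputable fun p => phi (p 0) (tail p) := by
  refine isComputable_of_option (fun x => x.1.head?.bind fun n => evalPrefix n x.1.tail x.2) ?_ ?_
  · exact (Primrec.option_bind (Primrec.list_head?.comp Primrec.fst)
      (.mk (primrec_evalPrefix_comp Primrec.snd
        (Primrec.list_tail.comp (Primrec.fst.comp Primrec.fst))
        (Primrec.snd.comp Primrec.fst)))).to_comp
  · intro p q hq m
    constructor
    · obtain ⟨j, hj⟩ := exists_evalPrefix hq m
      exact ⟨j + 1, by simpa [initSeg_succ] using hj⟩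
    · rintro (_ | j) v hv
      · simp [initSeg] at hv
      · exact eq_of_evalPrefix hq (by simpa [initSeg_succ] using hv)

theorem IsComputable.phi {N : Baire → ℕ} {f : Baire → Baire} (hN : NComp N) (hf : TComp f) :
    IsComputable fun p => phi (N p) (f p) :=
  (isComputable_universal.comp (TComp.cons hN hf)).mono fun p q hq => by
    simpa [cons_zero, tail_cons] using hq

/-- Definition by cases on whether a number is zero. -/
theorem IsComputable.ite {N : Baire → ℕ} (hN : NComp N) {F G : Baire →. Baire}
    (hF : IsComputable F) (hG : IsComputable G) :
    IsComputable fun p => if N p = 0 then F p else G p := by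
  obtain ⟨a, ha⟩ := isComputable_iff.1 hF
  obtain ⟨b, hb⟩ := isComputable_iff.1 hG
  -- Only the program number is chosen by cases. The universal function then runs the selected
  -- program alone, so the other branch may diverge.
  have he : Computable fun n : ℕ => bif n == 0 then a else b :=
    (Primrec.cond (Primrec.beq.comp Primrec.id (Primrec.const 0)) (Primrec.const a)
      (Primrec.const b)).to_comp
  refine (IsComputable.phi (hN.map he) TComp.id).mono fun p q hq => ?_
  split_ifs at hq with h
  · simpa [h] using ha p q hq
  · have h' : (N p == 0) = false := by simpa using h
    simpa [h'] using hb p q hq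

/-! ### Completion at the level of names -/

/-- Relates the finite view of `p - 1`, obtained by deleting zeros from a prefix, to the enumeration
by `Nat.nth` in the definition of `dec`. -/
theorem filter_initSeg (p : Baire) (j : ℕ) :
    ((initSeg p j).filter fun a => a ≠ 0) =
      (List.range (Nat.count (fun n => p n ≠ 0) j)).map
        fun k => p (Nat.nth (fun n => p n ≠ 0) k) := by
  induction j with
  | zero => simp [initSeg]
  | succ j ih =>
    rw [initSeg_concat, List.filter_append, ih, Nat.count_succ]
    by_cases h : p j = 0
    · simp [h]
    · have h' : (fun n => p n ≠ 0) j := h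
      have := Nat.nth_count (p := fun n => p n ≠ 0) h'
      simp [h, List.range_succ, this]

theorem isComputable_dec : IsComputable dec := by
  refine isComputable_of_option
    (fun x => ((x.1.filter fun a => a ≠ 0)[x.2]?).map fun v => v - 1) ?_ ?_
  · refine (Primrec.option_map (Primrec.list_getElem?.comp ((Primrec.listFilter ?_).comp
      Primrec.fst) Primrec.snd) (.mk (Primrec.pred.comp Primrec.snd))).to_comp
    exact (Primrec.eq.comp Primrec.id (Primrec.const 0)).not
  · rintro p q ⟨hinf, rfl⟩ m
    simp only [filter_initSeg, dec]
    constructor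
    -- The prefix that ends with the nonzero entry of index `m` contains exactly `m + 1` nonzero
    -- entries.
    · refine ⟨Nat.nth (fun n => p n ≠ 0) m + 1, ?_⟩
      rw [Nat.count_nth_succ_of_infinite hinf]
      simp
    · intro j v hv
      simp only [List.getElem?_map, Option.map_map, Option.map_eq_some_iff] at hv
      obtain ⟨k, hk, rfl⟩ := hv
      rw [List.getElem?_eq_some_iff] at hk
      obtain ⟨_, hk⟩ := hk
      simp at hk
      simp [hk]

/-- How many values have been found before stage `s`, if `f s c` is the information about the
value at `c` that is available at stage `s`. -/
def padCount (f : ℕ → ℕ → Option ℕ) (s : ℕ) : ℕ :=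
  Nat.rec 0 (fun s c => bif (f s c).isSome then c + 1 else c) s

/-- The sequence of values, shifted by one, with a zero at each stage where no value is found. -/
def padOut (f : ℕ → ℕ → Option ℕ) (s : ℕ) : ℕ :=
  ((f s (padCount f s)).map Nat.succ).getD 0

theorem padCount_succ (f : ℕ → ℕ → Option ℕ) (s : ℕ) : padCount f (s + 1) =
    bif (f s (padCount f s)).isSome then padCount f s + 1 else padCount f s := rfl

theorem padCount_congr {f f' : ℕ → ℕ → Option ℕ} {s : ℕ} (h : ∀ i < s, f i = f' i) :
    padCount f s = padCount f' s := by
  induction s with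
  | zero => rfl
  | succ s ih =>
    rw [padCount_succ, padCount_succ, ih fun i hi => h i (hi.trans s.lt_succ_self),
      h s s.lt_succ_self]

theorem padOut_congr {f f' : ℕ → ℕ → Option ℕ} {s : ℕ} (h : ∀ i ≤ s, f i = f' i) :
    padOut f s = padOut f' s := by
  rw [padOut, padOut, padCount_congr fun i hi => h i hi.le, h s le_rfl]

theorem padOut_ne_zero {f : ℕ → ℕ → Option ℕ} {s : ℕ} :
    padOut f s ≠ 0 ↔ (f s (padCount f s)).isSome := by
  rw [padOut]; cases f s (padCount f s) <;> simp

theorem padCount_eq_count (f : ℕ → ℕ → Option ℕ) (s : ℕ) :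
    padCount f s = Nat.count (fun n => padOut f n ≠ 0) s := by
  induction s with
  | zero => simp [padCount]
  | succ s ih =>
    rw [padCount_succ, Nat.count_succ, ← ih]
    by_cases h : padOut f s ≠ 0
    · simp [h, padOut_ne_zero.1 h]
    · have h' : (f s (padCount f s)).isSome = false := by simpa using mt padOut_ne_zero.2 h
      simp [h, h']

/-- If only finitely many stages produced output, the counter would be stuck at some `c`, although
the value at `c` is eventually available at all stages. At the nonzero stage of index `k` the
counter equals `k`, so the entry written there is `q k + 1`. -/
theorem mem_dec_padOut {f : ℕ → ℕ → Option ℕ} {q : Baire}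
    (h1 : ∀ c, ∃ s₀, ∀ s ≥ s₀, (f s c).isSome) (h2 : ∀ s c v, f s c = some v → v = q c) :
    q ∈ dec (padOut f) := by
  have hinf : {n | padOut f n ≠ 0}.Infinite := by
    refine Set.infinite_of_forall_exists_gt fun N => ?_
    by_contra! hno
    have hconst : ∀ s ≥ N + 1, padCount f s = padCount f (N + 1) := by
      intro s hs
      induction s, hs using Nat.le_induction with
      | base => rfl
      | succ s hs ih =>
        have : (f s (padCount f s)).isSome = false := by
          by_contra hsome
          have := hno s (padOut_ne_zero.2 (by simpa only [Bool.not_eq_false] using hsome))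
          omega
        rw [padCount_succ, this, cond_false, ih]
    obtain ⟨s₀, hs₀⟩ := h1 (padCount f (N + 1))
    have hs := hs₀ _ (le_max_left s₀ (N + 1))
    rw [← hconst _ (le_max_right s₀ (N + 1))] at hs
    have := hno _ (padOut_ne_zero.2 hs)
    omega
  refine ⟨hinf, funext fun k => ?_⟩
  have hk : padOut f (Nat.nth (fun n => padOut f n ≠ 0) k) ≠ 0 := Nat.nth_mem_of_infinite hinf k
  have hc := padCount_eq_count f (Nat.nth (fun n => padOut f n ≠ 0) k)
  rw [Nat.count_nth_of_infinite hinf] at hc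
  obtain ⟨v, hv⟩ := Option.isSome_iff_exists.1 (padOut_ne_zero.1 hk)
  simp only [dec]
  rw [padOut, hv]
  rw [hc] at hv
  simpa using h2 _ _ _ hv

theorem primrec_padOut {α : Type*} [Primcodable α] {f : α → ℕ → ℕ → Option ℕ} {s : α → ℕ}
    (hf : Primrec fun x : α × ℕ × ℕ => f x.1 x.2.1 x.2.2) (hs : Primrec s) :
    Primrec fun a => padOut (f a) (s a) := by
  have hc : Primrec fun a => padCount (f a) (s a) := by
    refine Primrec.nat_rec' (g := fun _ => 0)
      (h := fun a x => bif (f a x.1 x.2).isSome then x.2 + 1 else x.2) hs (Primrec.const 0)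
      (.mk (Primrec.cond (Primrec.option_isSome.comp hf)
        (Primrec.succ.comp (Primrec.snd.comp Primrec.snd)) (Primrec.snd.comp Primrec.snd)))
  exact Primrec.option_getD.comp (Primrec.option_map (hf.comp (Primrec.id.pair (hs.pair hc)))
    (.mk (Primrec.succ.comp Primrec.snd))) (Primrec.const 0)

/-- A uniformly computable sequence of partial functions can be evaluated in parallel by a total
computable function, if the values are taken in the completion. -/
theorem IsComputable.exists_padding {F : Baire →. Baire} (hF : IsComputable F) :
    ∃ P, TComp P ∧ ∀ n p, ∀ q ∈ F (cons n p), q ∈ dec (proj n (P p)) := by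
  obtain ⟨a, ha⟩ := isComputable_iff.1 hF
  -- The position `m` codes a sequence number and a stage; component `n` is the padded run of `F` on
  -- `cons n p`.
  refine ⟨fun p m => padOut (fun s c => evalPrefix a (initSeg (cons m.unpair.1 p) s) c)
    m.unpair.2, ?_, ?_⟩
  · refine isComputable_of_option (fun x => if x.2.unpair.2 ≤ x.1.length then
      some (padOut (fun s c => evalPrefix a ((x.2.unpair.1 :: x.1).take s) c) x.2.unpair.2)
      else none) ?_ ?_
    · have hu : Primrec fun x : List ℕ × ℕ => x.2.unpair := Primrec.unpair.comp Primrec.snd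
      refine (Primrec.ite (Primrec.nat_le.comp (Primrec.snd.comp hu)
        (Primrec.list_length.comp Primrec.fst)) (Primrec.option_some.comp ?_)
        (Primrec.const none)).to_comp
      refine primrec_padOut (primrec_evalPrefix_comp (Primrec.const a) (Primrec.list_take.comp
        (Primrec.fst.comp Primrec.snd) (Primrec.list_cons.comp (Primrec.fst.comp
        (hu.comp Primrec.fst)) (Primrec.fst.comp Primrec.fst)))
        (Primrec.snd.comp Primrec.snd)) (Primrec.snd.comp hu)
    · intro p q hq m
      obtain rfl := Part.mem_some_iff.1 hq
      -- Stage `s` inspects only prefixes of length at most `s`, so any longer prefix of `p` gives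
      -- the same entry.
      have key : ∀ j, m.unpair.2 ≤ j →
          padOut (fun s c => evalPrefix a ((m.unpair.1 :: initSeg p j).take s) c) m.unpair.2 =
          padOut (fun s c => evalPrefix a (initSeg (cons m.unpair.1 p) s) c) m.unpair.2 := by
        intro j hj
        refine padOut_congr fun i hi => ?_
        have : m.unpair.1 :: initSeg p j = initSeg (cons m.unpair.1 p) (j + 1) := by
          rw [initSeg_succ, tail_cons, cons_zero]
        rw [this, take_initSeg _ (by omega)]
      simp only [length_initSeg]
      refine ⟨⟨m.unpair.2, by simp [key]⟩, fun j v hv => ?_⟩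
      split_ifs at hv with h
      rw [key j h] at hv
      exact (Option.some_inj.1 hv).symm
  · intro n p q hq
    have hq := ha _ _ hq
    have : proj n (fun m => padOut (fun s c => evalPrefix a (initSeg (cons m.unpair.1 p) s) c)
        m.unpair.2) = padOut (fun s c => evalPrefix a (initSeg (cons n p) s) c) := by
      funext k; simp [proj]
    rw [this]
    refine mem_dec_padOut (fun c => ?_) fun s c v hv => eq_of_evalPrefix hq hv
    obtain ⟨j, hj⟩ := exists_evalPrefix hq c
    exact ⟨j, fun s hs => by simp [evalPrefix_mono hs hj]⟩

/-! ### Realizer versions -/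

theorem some_mem_rep_compl {X : RepSpace} {p : Baire} {x : X.carrier} :
    (some x : Option X.carrier) ∈ X.compl.rep p ↔ ∃ p' ∈ dec p, x ∈ X.rep p' := by
  classical
  refine Iff.trans (b := some x = ((dec p).bind X.rep).toOption) ?_ ?_
  · refine Part.mem_some_iff.trans ?_
    congr!
  · rw [eq_comm, Part.toOption_eq_some_iff]
    exact Part.mem_bind_iff

namespace Problem

theorem nonempty_real {f : Problem} {p : Baire} :
    (f.real p).Nonempty ↔ ∃ x ∈ f.src.rep p, x ∈ f.dom := by
  constructor
  · rintro ⟨q, x, hx, y, -, hy⟩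
    exact ⟨x, hx, y, hy⟩
  · rintro ⟨x, hx, y, hy⟩
    obtain ⟨q, hq⟩ := f.tgt.surj y
    exact ⟨q, x, hx, y, hq, hy⟩

theorem mem_real_of_mem_rep {f : Problem} {p q : Baire} {x : f.src.carrier}
    (hx : x ∈ f.src.rep p) : q ∈ f.real p ↔ ∃ y ∈ f.tgt.rep q, y ∈ f.val x := by
  constructor
  · rintro ⟨x', hx', h⟩
    rwa [Part.mem_unique hx hx']
  · intro h
    exact ⟨x, hx, h⟩

theorem realizes_iff {F : Baire →. Baire} {f : Problem} :
    Realizes F f ↔ ∀ p, (f.real p).Nonempty → ∃ q ∈ F p, q ∈ f.real p := by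
  constructor
  · intro h p hp
    obtain ⟨x, hx, hd⟩ := nonempty_real.1 hp
    obtain ⟨q, hq, hy⟩ := h p x hx hd
    exact ⟨q, hq, (mem_real_of_mem_rep hx).2 hy⟩
  · intro h p x hx hd
    obtain ⟨q, hq, hy⟩ := h p (nonempty_real.2 ⟨x, hx, hd⟩)
    exact ⟨q, hq, (mem_real_of_mem_rep hx).1 hy⟩

/-- Weihrauch reducibility in terms of realizer versions. -/
theorem leW_iff {f g : Problem} : f.LeW g ↔ ∃ H K : Baire →. Baire, IsComputable H ∧
    IsComputable K ∧ ∀ p, (f.real p).Nonempty → ∃ k ∈ K p, (g.real k).Nonempty ∧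
      ∀ t ∈ g.real k, ∃ q ∈ H (pair p t), q ∈ f.real p := by
  classical
  simp only [LeW, realizes_iff]
  refine exists_congr fun H => exists_congr fun K => and_congr_right fun _ =>
    and_congr_right fun _ => ⟨fun h p hp => ?_, fun h G hG p hp => ?_⟩
  -- Realizers with the least possible domain, given by a selection `s`: their convergence certifies
  -- that the query lies in the domain of `g`.
  · let G (s : Baire → Baire) : Baire →. Baire := fun k => ⟨(g.real k).Nonempty, fun _ => s k⟩
    have hG : ∀ s : Baire → Baire, (∀ k, (g.real k).Nonempty → s k ∈ g.real k) →
        ∃ k ∈ K p, (g.real k).Nonempty ∧ ∃ q ∈ H (pair p (s k)), q ∈ f.real p := by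
      intro s hs
      obtain ⟨q, hq, hqf⟩ := h (G s) (fun k hk => ⟨s k, ⟨hk, rfl⟩, hs k hk⟩) p hp
      simp only [sandwich, Part.mem_bind_iff] at hq
      obtain ⟨k, hk, t, ⟨hd, rfl⟩, hq⟩ := hq
      exact ⟨k, hk, hd, q, hq, hqf⟩
    have hchoice : ∀ k, ∃ s, (g.real k).Nonempty → s ∈ g.real k := by
      intro k
      by_cases hk : (g.real k).Nonempty
      · exact ⟨hk.some, fun _ => hk.some_mem⟩
      · exact ⟨k, fun h => absurd h hk⟩
    choose s hs using hchoice
    obtain ⟨k, hk, hd, -⟩ := hG s hs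
    -- The query `k` does not depend on the realizer. Changing the selection at `k` alone turns an
    -- arbitrary admissible `t` into the answer received.
    refine ⟨k, hk, hd, fun t ht => ?_⟩
    obtain ⟨k', hk', -, hq⟩ := hG (Function.update s k t) (fun k' hk' => by
      by_cases hkk : k' = k
      · subst hkk; simpa using ht
      · simpa [hkk] using hs k' hk')
    obtain rfl := Part.mem_unique hk hk'
    simpa using hq
  · obtain ⟨k, hk, hd, ht⟩ := h p hp
    obtain ⟨t, htG, htg⟩ := hG k hd
    obtain ⟨q, hq, hqf⟩ := ht t htg
    refine ⟨q, ?_, hqf⟩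
    simp only [sandwich, Part.mem_bind_iff]
    exact ⟨k, hk, t, htG, hq⟩

/-- Every sequence names a point of the completion, so an answer is constrained only when the input
decodes to a name of a point of `dom f`. Below, completions are handled through this condition and
`⊥` no longer appears. -/
theorem mem_real_compl {f : Problem} {p q : Baire} : q ∈ f.compl.real p ↔
    ∀ p' ∈ dec p, (f.real p').Nonempty → ∃ q' ∈ dec q, q' ∈ f.real p' := by
  have hq : ∃ y, y ∈ f.compl.tgt.rep q := ⟨_, Part.mem_some _⟩
  by_cases h : ∃ p' ∈ dec p, (f.real p').Nonempty
  · obtain ⟨p', hp', hne⟩ := h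
    obtain ⟨x, hx, hd⟩ := nonempty_real.1 hne
    have hz : (some x : Option f.src.carrier) ∈ f.compl.src.rep p :=
      some_mem_rep_compl.2 ⟨p', hp', hx⟩
    have hval : f.compl.val (some x : Option f.src.carrier) = some '' f.val x := if_pos hd
    rw [mem_real_of_mem_rep hz, hval]
    constructor
    · rintro ⟨_, hy, y, hyf, rfl⟩ p'' hp'' -
      obtain ⟨q', hq', hyq⟩ := some_mem_rep_compl.1 hy
      obtain rfl := Part.mem_unique hp' hp''
      exact ⟨q', hq', (mem_real_of_mem_rep hx).2 ⟨y, hyq, hyf⟩⟩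
    · intro h
      obtain ⟨q', hq', hqf⟩ := h p' hp' hne
      obtain ⟨y, hyq, hyf⟩ := (mem_real_of_mem_rep hx).1 hqf
      exact ⟨some y, some_mem_rep_compl.2 ⟨q', hq', hyq⟩, y, hyf, rfl⟩
  · push Not at h
    refine iff_of_true ?_ fun p' hp' hne => absurd hne (by simp [h p' hp'])
    have huniv : ∀ z ∈ f.compl.src.rep p, f.compl.val z = Set.univ := by
      rintro (_ | x) hz
      · rfl
      · obtain ⟨p', hp', hx⟩ := some_mem_rep_compl.1 hz
        refine if_neg fun hd => ?_
        simpa [h p' hp'] using nonempty_real.2 ⟨x, hx, hd⟩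
    obtain ⟨y, hy⟩ := hq
    obtain ⟨z, hz⟩ : ∃ z, z ∈ f.compl.src.rep p := ⟨_, Part.mem_some _⟩
    exact ⟨z, hz, y, hy, by rw [huniv z hz]; trivial⟩

theorem mem_rep_pow {X : RepSpace} {p : Baire} {x : ℕ → X.carrier} :
    x ∈ X.pow.rep p ↔ ∀ n, x n ∈ X.rep (proj n p) := by
  constructor
  · rintro ⟨h, rfl⟩ n
    exact Part.get_mem (h n)
  · intro h
    exact ⟨fun n => Part.dom_iff_mem.2 ⟨_, h n⟩,
      funext fun n => Part.get_eq_of_mem (h n) (Part.dom_iff_mem.2 ⟨_, h n⟩)⟩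

theorem mem_real_par {f : Problem} {p q : Baire} :
    q ∈ f.par.real p ↔ ∀ n, proj n q ∈ f.real (proj n p) := by
  constructor
  · rintro ⟨x, hx, y, hy, h⟩ n
    exact ⟨x n, mem_rep_pow.1 hx n, y n, mem_rep_pow.1 hy n, h n⟩
  · intro h
    choose x hx y hy hxy using h
    exact ⟨x, mem_rep_pow.2 hx, y, mem_rep_pow.2 hy, hxy⟩

/-- The parallelized completion of `f`. -/
noncomputable def total (f : Problem) : Problem := f.compl.par

theorem mem_real_total {f : Problem} {p q : Baire} : q ∈ f.total.real p ↔
    ∀ n, ∀ p' ∈ dec (proj n p), (f.real p').Nonempty →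
      ∃ q' ∈ dec (proj n q), q' ∈ f.real p' := by
  simp only [total, mem_real_par, mem_real_compl]

theorem exists_dec_eq (f : ℕ → Baire) : ∃ r, ∀ n, f n ∈ dec (proj n r) := by
  refine ⟨fun i => f i.unpair.1 i.unpair.2 + 1, fun n => ?_⟩
  have : proj n (fun i => f i.unpair.1 i.unpair.2 + 1) = fun k => f n k + 1 := by
    funext k; simp [proj]
  rw [this]
  exact dec_succ _

/-- Totality discharges the domain conditions in reductions to `total` and in the strict composition
inside `↠`. -/
theorem nonempty_real_total (f : Problem) (p : Baire) : (f.total.real p).Nonempty := by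
  classical
  have : ∀ n, ∃ q, ∀ p' ∈ dec (proj n p), (f.real p').Nonempty → q ∈ f.real p' := by
    intro n
    by_cases h : ∃ p' ∈ dec (proj n p), (f.real p').Nonempty
    · obtain ⟨p', hp', q, hq⟩ := h
      exact ⟨q, fun p'' hp'' _ => Part.mem_unique hp' hp'' ▸ hq⟩
    · exact ⟨p, fun p' hp' hne => absurd ⟨p', hp', hne⟩ h⟩
  choose q hq using this
  obtain ⟨r, hr⟩ := exists_dec_eq q
  exact ⟨r, mem_real_total.2 fun n p' hp' hne => ⟨q n, hr n, hq n p' hp' hne⟩⟩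

theorem mem_real_one {p q : Baire} : q ∈ one.real p ↔ q = p := by
  have hp : p ∈ one.src.rep p := Part.mem_some p
  rw [mem_real_of_mem_rep hp]
  exact ⟨fun ⟨y, hy, h⟩ => (Part.mem_some_iff.1 hy).symm.trans h,
    fun h => ⟨q, Part.mem_some q, h⟩⟩

theorem real_const (A : Set Baire) (p : Baire) : (const A).real p = A := by
  ext q
  have hp : p ∈ (const A).src.rep p := Part.mem_some p
  rw [mem_real_of_mem_rep hp]
  exact ⟨fun ⟨y, hy, h⟩ => by rwa [← Part.mem_some_iff.1 hy], fun h => ⟨q, Part.mem_some q, h⟩⟩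

theorem real_zero (p : Baire) : zero.real p = ∅ := real_const ∅ p

theorem mem_real_mimpAux {g f : Problem} {p w : Baire} : w ∈ (mimpAux g f).real p ↔
    ∃ (n k : ℕ) (s : Baire), w = cons n (cons k s) ∧
      ∃ r ∈ phi k p, (g.real r).Nonempty ∧
        ∀ t ∈ g.real r, ∃ v ∈ phi n (pair s t), v ∈ f.real p := by
  have hp : p ∈ (mimpAux g f).src.rep p := Part.mem_some p
  rw [mem_real_of_mem_rep hp]
  exact ⟨fun ⟨y, hy, h⟩ => by rwa [← Part.mem_some_iff.1 hy], fun h => ⟨w, Part.mem_some w, h⟩⟩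

/-! ### Realizer versions of coproducts and meets -/

theorem mem_rep_sum_inl {X Y : RepSpace} {p : Baire} {x : X.carrier} :
    (Sum.inl x : X.carrier ⊕ Y.carrier) ∈ (X.sum Y).rep p ↔ p 0 = 0 ∧ x ∈ X.rep (tail p) := by
  have key : ∀ (n : ℕ) (a : Part X.carrier) (b : Part Y.carrier), Sum.inl x ∈
      (if n = 0 then a.map Sum.inl else if n = 1 then b.map Sum.inr else Part.none :
        Part (X.carrier ⊕ Y.carrier)) ↔ n = 0 ∧ x ∈ a := by
    intro n a b
    split_ifs <;> simp [*]
  exact key _ _ _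

theorem mem_rep_sum_inr {X Y : RepSpace} {p : Baire} {y : Y.carrier} :
    (Sum.inr y : X.carrier ⊕ Y.carrier) ∈ (X.sum Y).rep p ↔ p 0 = 1 ∧ y ∈ Y.rep (tail p) := by
  have key : ∀ (n : ℕ) (a : Part X.carrier) (b : Part Y.carrier), Sum.inr y ∈
      (if n = 0 then a.map Sum.inl else if n = 1 then b.map Sum.inr else Part.none :
        Part (X.carrier ⊕ Y.carrier)) ↔ n = 1 ∧ y ∈ b := by
    intro n a b
    split_ifs <;> simp [*]
  exact key _ _ _

theorem mem_real_coprod {f g : Problem} {p q : Baire} : q ∈ (coprod f g).real p ↔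
    (p 0 = 0 ∧ q 0 = 0 ∧ tail q ∈ f.real (tail p)) ∨
      (p 0 = 1 ∧ q 0 = 1 ∧ tail q ∈ g.real (tail p)) := by
  constructor
  · rintro ⟨x | x, hx, z, hz, hv⟩
    · obtain ⟨y, hy, rfl⟩ := hv
      obtain ⟨h1, h2⟩ := mem_rep_sum_inl.1 hx
      obtain ⟨h3, h4⟩ := mem_rep_sum_inl.1 hz
      exact Or.inl ⟨h1, h3, x, h2, y, h4, hy⟩
    · obtain ⟨y, hy, rfl⟩ := hv
      obtain ⟨h1, h2⟩ := mem_rep_sum_inr.1 hx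
      obtain ⟨h3, h4⟩ := mem_rep_sum_inr.1 hz
      exact Or.inr ⟨h1, h3, x, h2, y, h4, hy⟩
  · rintro (⟨h1, h3, x, h2, y, h4, hy⟩ | ⟨h1, h3, x, h2, y, h4, hy⟩)
    · exact ⟨Sum.inl x, mem_rep_sum_inl.2 ⟨h1, h2⟩, Sum.inl y, mem_rep_sum_inl.2 ⟨h3, h4⟩,
        y, hy, rfl⟩
    · exact ⟨Sum.inr x, mem_rep_sum_inr.2 ⟨h1, h2⟩, Sum.inr y, mem_rep_sum_inr.2 ⟨h3, h4⟩,
        y, hy, rfl⟩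

theorem mem_rep_prod {X Y : RepSpace} {p : Baire} {z : X.carrier × Y.carrier} :
    z ∈ (X.prod Y).rep p ↔ z.1 ∈ X.rep (fst p) ∧ z.2 ∈ Y.rep (snd p) := by
  have key : ∀ (a : Part X.carrier) (b : Part Y.carrier), z ∈ (a.bind fun x =>
      b.map fun y => (x, y)) ↔ z.1 ∈ a ∧ z.2 ∈ b := by
    intro a b
    obtain ⟨x, y⟩ := z
    simp
  exact key _ _

theorem mem_real_meet {f g : Problem} {p q : Baire} : q ∈ (meet f g).real p ↔
    (f.real (fst p)).Nonempty ∧ (g.real (snd p)).Nonempty ∧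
      ((q 0 = 0 ∧ tail q ∈ f.real (fst p)) ∨ (q 0 = 1 ∧ tail q ∈ g.real (snd p))) := by
  constructor
  · rintro ⟨x, hx, z, hz, hf, hg, hv⟩
    obtain ⟨h1, h2⟩ := mem_rep_prod.1 hx
    refine ⟨nonempty_real.2 ⟨_, h1, hf⟩, nonempty_real.2 ⟨_, h2, hg⟩, ?_⟩
    obtain ⟨y, hy, rfl⟩ | ⟨y, hy, rfl⟩ := hv
    · obtain ⟨h3, h4⟩ := mem_rep_sum_inl.1 hz
      exact Or.inl ⟨h3, x.1, h1, y, h4, hy⟩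
    · obtain ⟨h3, h4⟩ := mem_rep_sum_inr.1 hz
      exact Or.inr ⟨h3, x.2, h2, y, h4, hy⟩
  · rintro ⟨hf, hg, h⟩
    obtain ⟨x, hx, hxd⟩ := nonempty_real.1 hf
    obtain ⟨u, hu, hud⟩ := nonempty_real.1 hg
    have hz : ((x, u) : f.src.carrier × g.src.carrier) ∈ (meet f g).src.rep p :=
      mem_rep_prod.2 ⟨hx, hu⟩
    obtain ⟨h0, h⟩ | ⟨h0, h⟩ := h
    · obtain ⟨y, hy, hv⟩ := (mem_real_of_mem_rep hx).1 h
      exact ⟨(x, u), hz, Sum.inl y, mem_rep_sum_inl.2 ⟨h0, hy⟩, hxd, hud, Or.inl ⟨y, hv, rfl⟩⟩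
    · obtain ⟨y, hy, hv⟩ := (mem_real_of_mem_rep hu).1 h
      exact ⟨(x, u), hz, Sum.inr y, mem_rep_sum_inr.2 ⟨h0, hy⟩, hxd, hud, Or.inr ⟨y, hv, rfl⟩⟩

end Problem

theorem IsComputable.map {F : Baire →. Baire} {f : Baire → Baire} (hF : IsComputable F)
    (hf : TComp f) : IsComputable fun p => (F p).map f :=
  (hF.bind_const hf).mono fun p q hq => by
    obtain ⟨r, hr, rfl⟩ := (Part.mem_map_iff _).1 hq
    exact Part.mem_bind hr (Part.mem_some _)

theorem IsComputable.dec {f : Baire → Baire} (hf : TComp f) : IsComputable fun p => dec (f p) :=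
  isComputable_dec.comp hf

theorem mem_dec_proj_replicate {n : ℕ} {p : Baire} :
    p ∈ dec (proj n (replicate fun k => p k + 1)) := by
  rw [proj_replicate]; exact dec_succ p

namespace Problem

/-! ### Weihrauch reducibility to parallelized completions -/

theorem leW_of {f g : Problem} {H : Baire →. Baire} {k : Baire → Baire} (hH : IsComputable H)
    (hk : TComp k) (h : ∀ p, (f.real p).Nonempty → (g.real (k p)).Nonempty ∧
      ∀ t ∈ g.real (k p), ∃ q ∈ H (pair p t), q ∈ f.real p) : f.LeW g :=
  leW_iff.2 ⟨H, _, hH, hk, fun p hp => ⟨k p, Part.mem_some _, h p hp⟩⟩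

theorem LeW.trans {f g h : Problem} (hfg : f.LeW g) (hgh : g.LeW h) : f.LeW h := by
  obtain ⟨H, K, hH, hK, h1⟩ := leW_iff.1 hfg
  obtain ⟨H', K', hH', hK', h2⟩ := leW_iff.1 hgh
  -- The outer function receives only the input and the final answer, so the intermediate query `K
  -- (fst v)` is recomputed.
  refine leW_iff.2 ⟨fun v => (K (fst v)).bind fun k => (H' (pair k (snd v))).bind fun t =>
    H (pair (fst v) t), _, ?_, hK.bind_const hK', fun p hp => ?_⟩
  · exact (hK.comp tComp_fst).bind ((hH'.comp (TComp.id.snd.pair TComp.id.fst.snd)).bind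
      (hH.comp (TComp.id.fst.fst.fst.pair TComp.id.snd)))
  · obtain ⟨k, hk, hg, hH⟩ := h1 p hp
    obtain ⟨k', hk', hh, hH'⟩ := h2 k hg
    refine ⟨k', Part.mem_bind hk hk', hh, fun t ht => ?_⟩
    obtain ⟨t', ht', htg⟩ := hH' t ht
    obtain ⟨q, hq, hqf⟩ := hH t' htg
    refine ⟨q, ?_, hqf⟩
    simp only [fst_pair, snd_pair]
    exact Part.mem_bind hk (Part.mem_bind ht' hq)

theorem leW_total (f : Problem) : f.LeW f.total := by
  refine leW_of (H := fun v => dec (proj 0 (snd v))) (IsComputable.dec (.proj (.const 0) tComp_snd))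
    tComp_succ.replicate fun p hp => ⟨nonempty_real_total _ _, fun t ht => ?_⟩
  rw [snd_pair]
  exact mem_real_total.1 ht 0 p mem_dec_proj_replicate hp

/-- The total problem accepts any query, and its answer is ignored. -/
theorem leW_total_of_computable {f : Problem} {F : Baire →. Baire} (hF : IsComputable F)
    (h : ∀ p, (f.real p).Nonempty → ∃ q ∈ F p, q ∈ f.real p) (g : Problem) :
    f.LeW g.total :=
  leW_of (hF.comp tComp_fst) TComp.id fun p hp =>
    ⟨nonempty_real_total _ _, fun t _ => by simpa only [fst_pair] using h p hp⟩

/-- Idempotence of `total` in disguise: the queries belonging to all instances `n` are merged into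
one sequence indexed by pairs `⟨n, i⟩`. Instances that are undefined or outside `dom f` may make `K`
or `H` diverge; padding absorbs this. -/
theorem LeW.total {f g : Problem} (hfg : f.LeW g.total) : f.total.LeW g.total := by
  obtain ⟨H, K, hH, hK, h⟩ := leW_iff.1 hfg
  obtain ⟨P, hP, hPdec⟩ := IsComputable.exists_padding (F := fun w =>
      (dec (proj (w 0).unpair.1 (tail w))).bind fun p => (K p).bind fun k =>
        dec (proj (w 0).unpair.2 k))
    ((IsComputable.dec (.proj (TComp.id.apply 0).unpair_fst tComp_tail)).bind
      ((hK.comp tComp_snd).bind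
        (.dec (.proj (TComp.id.fst.fst.apply 0).unpair_snd tComp_snd))))
  obtain ⟨Q, hQ, hQdec⟩ := IsComputable.exists_padding (F := fun w =>
      (dec (proj (w 0) (fst (tail w)))).bind fun p => H (pair p (row (w 0) (snd (tail w)))))
    ((IsComputable.dec (.proj (TComp.id.apply 0) tComp_tail.fst)).bind
      (hH.comp (tComp_snd.pair (.row (tComp_fst.apply 0) tComp_fst.tail.snd))))
  refine leW_of hQ hP fun r _ => ⟨nonempty_real_total _ _, fun t ht => ?_⟩
  refine ⟨_, Part.mem_some _, mem_real_total.2 fun n p hp hne => ?_⟩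
  obtain ⟨k, hk, -, hkt⟩ := h p hne
  have hrow : row n t ∈ g.total.real k := mem_real_total.2 fun i d hd hdne => by
    rw [proj_row]
    refine mem_real_total.1 ht (Nat.pair n i) d (hPdec _ _ _ ?_) hdne
    simp only [cons_zero, tail_cons, Nat.unpair_pair]
    exact Part.mem_bind hp (Part.mem_bind hk hd)
  obtain ⟨q, hq, hqf⟩ := hkt _ hrow
  refine ⟨q, hQdec _ _ _ ?_, hqf⟩
  simp only [cons_zero, tail_cons, fst_pair, snd_pair]
  exact Part.mem_bind hp hq

theorem leW_coprod_left (f g : Problem) : f.LeW (coprod f g) := by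
  refine leW_of (tComp_snd.tail) (.cons (.const 0) .id) fun p ⟨q, hq⟩ => ⟨⟨cons 0 q, ?_⟩, ?_⟩
  · exact mem_real_coprod.2 (.inl ⟨rfl, rfl, hq⟩)
  · intro t ht
    refine ⟨_, Part.mem_some _, ?_⟩
    simp only [snd_pair]
    obtain ⟨-, -, h⟩ | ⟨h, -⟩ := mem_real_coprod.1 ht
    · exact h
    · exact absurd h zero_ne_one

theorem leW_coprod_right (f g : Problem) : g.LeW (coprod f g) := by
  refine leW_of (tComp_snd.tail) (.cons (.const 1) .id) fun p ⟨q, hq⟩ => ⟨⟨cons 1 q, ?_⟩, ?_⟩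
  · exact mem_real_coprod.2 (.inr ⟨rfl, rfl, hq⟩)
  · intro t ht
    refine ⟨_, Part.mem_some _, ?_⟩
    simp only [snd_pair]
    obtain ⟨h, -⟩ | ⟨-, -, h⟩ := mem_real_coprod.1 ht
    · exact absurd h one_ne_zero
    · exact h

theorem coprod_leW {f g h : Problem} (hf : f.LeW h) (hg : g.LeW h) : (coprod f g).LeW h := by
  obtain ⟨H, K, hH, hK, h1⟩ := leW_iff.1 hf
  obtain ⟨H', K', hH', hK', h2⟩ := leW_iff.1 hg
  refine leW_iff.2 ⟨fun v => if fst v 0 = 0 then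
      (H (pair (tail (fst v)) (snd v))).map (cons 0)
      else (H' (pair (tail (fst v)) (snd v))).map (cons 1),
    fun p => if p 0 = 0 then K (tail p) else K' (tail p), ?_, ?_, fun p ⟨q, hq⟩ => ?_⟩
  · exact .ite (tComp_fst.apply 0)
      ((hH.comp (tComp_fst.tail.pair tComp_snd)).map (.cons (.const 0) .id))
      ((hH'.comp (tComp_fst.tail.pair tComp_snd)).map (.cons (.const 1) .id))
  · exact .ite (TComp.id.apply 0) (hK.comp tComp_tail) (hK'.comp tComp_tail)
  · simp only [fst_pair, snd_pair]
    obtain ⟨hp, -, hq⟩ | ⟨hp, -, hq⟩ := mem_real_coprod.1 hq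
    · obtain ⟨k, hk, hne, ht⟩ := h1 _ ⟨_, hq⟩
      refine ⟨k, by simpa [hp] using hk, hne, fun t htk => ?_⟩
      obtain ⟨q, hq, hqf⟩ := ht t htk
      refine ⟨cons 0 q, ?_, mem_real_coprod.2 (.inl ⟨hp, rfl, hqf⟩)⟩
      rw [if_pos hp]
      exact Part.mem_map _ hq
    · obtain ⟨k, hk, hne, ht⟩ := h2 _ ⟨_, hq⟩
      refine ⟨k, by simpa [hp] using hk, hne, fun t htk => ?_⟩
      obtain ⟨q, hq, hqf⟩ := ht t htk
      refine ⟨cons 1 q, ?_, mem_real_coprod.2 (.inr ⟨hp, rfl, hqf⟩)⟩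
      rw [if_neg (by simp [hp])]
      exact Part.mem_map _ hq

theorem meet_leW_left (f g : Problem) : (meet f g).LeW f := by
  refine leW_of (TComp.cons (.const 0) tComp_snd) tComp_fst fun p ⟨q, hq⟩ => ?_
  obtain ⟨hf, hg, -⟩ := mem_real_meet.1 hq
  refine ⟨hf, fun t ht => ⟨_, Part.mem_some _, ?_⟩⟩
  simp only [snd_pair]
  exact mem_real_meet.2 ⟨hf, hg, .inl ⟨rfl, ht⟩⟩

theorem meet_leW_right (f g : Problem) : (meet f g).LeW g := by
  refine leW_of (TComp.cons (.const 1) tComp_snd) tComp_snd fun p ⟨q, hq⟩ => ?_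
  obtain ⟨hf, hg, -⟩ := mem_real_meet.1 hq
  refine ⟨hg, fun t ht => ⟨_, Part.mem_some _, ?_⟩⟩
  simp only [snd_pair]
  exact mem_real_meet.2 ⟨hf, hg, .inr ⟨rfl, ht⟩⟩

theorem leW_meet {f g h : Problem} (hf : h.LeW f) (hg : h.LeW g) : h.LeW (meet f g) := by
  obtain ⟨H, K, hH, hK, h1⟩ := leW_iff.1 hf
  obtain ⟨H', K', hH', hK', h2⟩ := leW_iff.1 hg
  refine leW_iff.2 ⟨fun v => if snd v 0 = 0 then H (pair (fst v) (tail (snd v)))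
      else H' (pair (fst v) (tail (snd v))), _, ?_, hK.pair hK', fun p hp => ?_⟩
  · exact .ite (tComp_snd.apply 0) (hH.comp (tComp_fst.pair tComp_snd.tail))
      (hH'.comp (tComp_fst.pair tComp_snd.tail))
  · obtain ⟨k, hk, hne, ht⟩ := h1 p hp
    obtain ⟨k', hk', hne', ht'⟩ := h2 p hp
    refine ⟨pair k k', Part.mem_bind hk (Part.mem_map _ hk'), ?_, fun t htm => ?_⟩
    · obtain ⟨q, hq⟩ := hne
      exact ⟨cons 0 q, mem_real_meet.2 (by
        simp only [fst_pair, snd_pair]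
        exact ⟨⟨q, hq⟩, hne', .inl ⟨rfl, hq⟩⟩)⟩
    · have htm := (mem_real_meet.1 htm).2.2
      simp only [fst_pair, snd_pair] at htm ⊢
      obtain ⟨h0, htm⟩ | ⟨h0, htm⟩ := htm
      · simpa only [h0, if_true] using ht _ htm
      · simpa only [h0, one_ne_zero, if_false] using ht' _ htm

/-! ### Residuation -/

/-- The parameter `s` may be noncomputable, so a solution of `f` can be stored there and returned
without using `g`. -/
theorem nonempty_real_mimpAux_total (f g : Problem) (p : Baire) :
    ((mimpAux g.total f.total).real p).Nonempty := by
  obtain ⟨a, ha⟩ := nonempty_real_total f p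
  obtain ⟨n, hn⟩ := isComputable_iff.1 (show IsComputable _ from tComp_fst)
  obtain ⟨k, hk⟩ := isComputable_iff.1 (show IsComputable _ from TComp.id)
  refine ⟨_, mem_real_mimpAux.2 ⟨n, k, a, rfl, p, hk _ _ (Part.mem_some _),
    nonempty_real_total _ _, fun t _ => ⟨a, hn _ _ ?_, ha⟩⟩⟩
  rw [fst_pair]
  exact Part.mem_some _

/-- The component queries to `g ⊔ h` are stripped of their tags and all sent to both problems. The
answer of `h` is stored, with `p`, in the parameter `s`; once `g` has answered, the tags decide
which answer to use in each component. -/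
theorem mimpAux_leW_of_leW_coprod {f g h : Problem} (hf : f.LeW (coprod g h).total) :
    (mimpAux g.total f.total).LeW h.total := by
  obtain ⟨H, K, hH, hK, hHK⟩ := leW_iff.1 hf.total
  obtain ⟨P, hP, hPdec⟩ := IsComputable.exists_padding (F := fun w =>
      (K (tail w)).bind fun k => (dec (proj (w 0) k)).map tail)
    ((hK.comp tComp_tail).bind
      ((IsComputable.dec (.proj (tComp_fst.apply 0) tComp_snd)).map tComp_tail))
  -- The tag `d 0` is read off the recomputed query. Here `w` holds the component number followed by
  -- `⟨⟨p, t⟩, u⟩`, with `t` the answer of `h` and `u` that of `g`.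
  obtain ⟨Q, hQ, hQdec⟩ := IsComputable.exists_padding (F := fun w =>
      (K (fst (fst (tail w)))).bind fun k => (dec (proj (w 0) k)).bind fun d =>
        if d 0 = 0 then (dec (proj (w 0) (snd (tail w)))).map (cons 0)
        else (dec (proj (w 0) (snd (fst (tail w))))).map (cons 1))
    ((hK.comp tComp_tail.fst.fst).bind
      ((IsComputable.dec (.proj (tComp_fst.apply 0) tComp_snd)).bind
        (.ite (tComp_snd.apply 0)
          ((IsComputable.dec (.proj (tComp_fst.fst.apply 0) tComp_fst.fst.tail.snd)).map
            (.cons (.const 0) .id))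
          ((IsComputable.dec (.proj (tComp_fst.fst.apply 0) tComp_fst.fst.tail.fst.snd)).map
            (.cons (.const 1) .id)))))
  obtain ⟨n, hn⟩ := isComputable_iff.1 (hH.comp (tComp_fst.fst.pair hQ))
  obtain ⟨m, hm⟩ := isComputable_iff.1 (show IsComputable _ from hP)
  refine leW_of (TComp.cons (.const n) (.cons (.const m) .id)) hP fun p _ =>
    ⟨nonempty_real_total _ _, fun t ht => ⟨_, Part.mem_some _, mem_real_mimpAux.2
      ⟨n, m, pair p t, rfl, P p, hm _ _ (Part.mem_some _), nonempty_real_total _ _,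
        fun u hu => ?_⟩⟩⟩
  obtain ⟨k, hk, -, hkt⟩ := hHK p (nonempty_real_total _ _)
  have hmem : Q (pair (pair p t) u) ∈ (coprod g h).total.real k := by
    refine mem_real_total.2 fun i d hd ⟨q, hq⟩ => ?_
    have hPi : tail d ∈ dec (proj i (P p)) := by
      refine hPdec _ _ _ ?_
      simp only [cons_zero, tail_cons]
      exact Part.mem_bind hk (Part.mem_map _ hd)
    obtain ⟨hd0, -, hq⟩ | ⟨hd0, -, hq⟩ := mem_real_coprod.1 hq
    · obtain ⟨q', hq', hqg⟩ := mem_real_total.1 hu i _ hPi ⟨_, hq⟩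
      refine ⟨cons 0 q', hQdec _ _ _ ?_, mem_real_coprod.2 (.inl ⟨hd0, rfl, hqg⟩)⟩
      simp only [cons_zero, tail_cons, fst_pair, snd_pair]
      refine Part.mem_bind hk (Part.mem_bind hd ?_)
      rw [if_pos hd0]
      exact Part.mem_map _ hq'
    · obtain ⟨q', hq', hqg⟩ := mem_real_total.1 ht i _ hPi ⟨_, hq⟩
      refine ⟨cons 1 q', hQdec _ _ _ ?_, mem_real_coprod.2 (.inr ⟨hd0, rfl, hqg⟩)⟩
      simp only [cons_zero, tail_cons, fst_pair, snd_pair]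
      refine Part.mem_bind hk (Part.mem_bind hd ?_)
      rw [if_neg (by simp [hd0])]
      exact Part.mem_map _ hq'
  obtain ⟨v, hv, hvf⟩ := hkt _ hmem
  refine ⟨v, hn _ _ ?_, hvf⟩
  simpa only [fst_pair] using hv

/-- Which query `φₖ(p)` goes to `g` depends on the answer of `h`, so all of them are asked
simultaneously, and the row belonging to the right `k` is selected afterwards. -/
theorem leW_coprod_of_mimpAux_leW {f g h : Problem}
    (hf : (mimpAux g.total f.total).LeW h.total) : f.LeW (coprod g h).total := by
  refine (leW_total f).trans ?_
  obtain ⟨H, K, hH, hK, hHK⟩ := leW_iff.1 hf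
  -- Row `0` holds the query to `h`, tagged `1`; row `k + 1` holds `φₖ(p)`, tagged `0` for `g`.
  obtain ⟨P, hP, hPdec⟩ := IsComputable.exists_padding (F := fun w =>
      if (w 0).unpair.1 = 0 then
        (K (tail w)).bind fun k => (dec (proj (w 0).unpair.2 k)).map (cons 1)
      else (phi ((w 0).unpair.1 - 1) (tail w)).bind fun r =>
        (dec (proj (w 0).unpair.2 r)).map (cons 0))
    (.ite (TComp.id.apply 0).unpair_fst
      ((hK.comp tComp_tail).bind ((IsComputable.dec
        (.proj (tComp_fst.apply 0).unpair_snd tComp_snd)).map (.cons (.const 1) .id)))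
      ((IsComputable.phi ((TComp.id.apply 0).unpair_fst.map Primrec.pred.to_comp)
        tComp_tail).bind ((IsComputable.dec
        (.proj (tComp_fst.apply 0).unpair_snd tComp_snd)).map (.cons (.const 0) .id))))
  obtain ⟨Q, hQ, hQdec⟩ := IsComputable.exists_padding (F := fun w =>
      (dec (proj (w 0) (tail w))).map tail)
    ((IsComputable.dec (.proj (TComp.id.apply 0) tComp_tail)).map tComp_tail)
  refine leW_of (H := fun v => (H (pair (fst v) (Q (row 0 (snd v))))).bind fun q =>
      phi (q 0) (pair (tail (tail q)) (Q (row (tail q 0 + 1) (snd v)))))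
    ((hH.comp (tComp_fst.pair (hQ.comp (.row (.const 0) tComp_snd)))).bind
      (.phi (tComp_snd.apply 0) (tComp_snd.tail.tail.pair
        (hQ.comp (.row ((tComp_snd.tail.apply 0).map Primrec.succ.to_comp) tComp_fst.snd)))))
    hP fun p _ => ⟨nonempty_real_total _ _, fun y hy => ?_⟩
  obtain ⟨k, hk, -, hkt⟩ := hHK p (nonempty_real_mimpAux_total f g p)
  have hQh : Q (row 0 y) ∈ h.total.real k := by
    refine mem_real_total.2 fun j d hd ⟨a, ha⟩ => ?_
    have hPj : cons 1 d ∈ dec (proj (Nat.pair 0 j) (P p)) := by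
      refine hPdec _ _ _ ?_
      simp only [cons_zero, tail_cons, Nat.unpair_pair, if_true]
      exact Part.mem_bind hk (Part.mem_map _ hd)
    obtain ⟨q, hq, hqc⟩ := mem_real_total.1 hy _ _ hPj
      ⟨cons 1 a, mem_real_coprod.2 (.inr ⟨rfl, rfl, ha⟩)⟩
    obtain ⟨h0, -⟩ | ⟨-, -, hqh⟩ := mem_real_coprod.1 hqc
    · exact absurd h0 one_ne_zero
    · refine ⟨tail q, hQdec _ _ _ ?_, hqh⟩
      simp only [cons_zero, tail_cons, proj_row]
      exact Part.mem_map _ hq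
  obtain ⟨w, hw, hwf⟩ := hkt _ hQh
  obtain ⟨n, m, s, rfl, r, hr, -, hrt⟩ := mem_real_mimpAux.1 hwf
  have hQg : Q (row (m + 1) y) ∈ g.total.real r := by
    refine mem_real_total.2 fun j d hd ⟨a, ha⟩ => ?_
    have hPj : cons 0 d ∈ dec (proj (Nat.pair (m + 1) j) (P p)) := by
      refine hPdec _ _ _ ?_
      simp only [cons_zero, tail_cons, Nat.unpair_pair, Nat.succ_ne_zero, if_false,
        Nat.add_sub_cancel]
      exact Part.mem_bind hr (Part.mem_map _ hd)
    obtain ⟨q, hq, hqc⟩ := mem_real_total.1 hy _ _ hPj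
      ⟨cons 0 a, mem_real_coprod.2 (.inl ⟨rfl, rfl, ha⟩)⟩
    obtain ⟨-, -, hqg⟩ | ⟨h0, -⟩ := mem_real_coprod.1 hqc
    · refine ⟨tail q, hQdec _ _ _ ?_, hqg⟩
      simp only [cons_zero, tail_cons, proj_row]
      exact Part.mem_map _ hq
    · exact absurd h0 zero_ne_one
  obtain ⟨v, hv, hvf⟩ := hrt _ hQg
  refine ⟨v, ?_, hvf⟩
  simp only [fst_pair, snd_pair]
  exact Part.mem_bind hw hv

/-! ### Constant problems -/

/-- Nonemptiness of `A` makes the zero sequence an instance of the left side; nonemptiness of `B`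
guarantees that a component of the right side is really answered by an element of `B`. -/
theorem const_leW_total_const_iff {A B : Set Baire} (hA : A.Nonempty) (hB : B.Nonempty) :
    (const A).LeW (const B).total ↔ LeM A B := by
  constructor
  · intro h
    obtain ⟨H, K, hH, hK, h⟩ := leW_iff.1 h
    refine ⟨fun b => H (pair (fun _ => 0) (replicate fun k => b k + 1)),
      hH.comp ((tComp_const 0).pair tComp_succ.replicate), fun b hb => ?_⟩
    obtain ⟨k, -, -, hk⟩ := h (fun _ => 0) (by rwa [real_const])
    rw [real_const] at hk
    refine hk _ (mem_real_total.2 fun n p _ _ => ⟨b, mem_dec_proj_replicate, ?_⟩)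
    rwa [real_const]
  · rintro ⟨F, hF, h⟩
    refine leW_of (H := fun v => (dec (proj 0 (snd v))).bind F)
      ((IsComputable.dec (.proj (.const 0) tComp_snd)).bind_const hF) tComp_succ.replicate
      fun p _ => ⟨nonempty_real_total _ _, fun t ht => ?_⟩
    obtain ⟨b, hb, hbB⟩ := mem_real_total.1 ht 0 p mem_dec_proj_replicate (by rwa [real_const])
    rw [real_const] at hbB ⊢
    obtain ⟨q, hq, hqA⟩ := h b hbB
    exact ⟨q, by rw [snd_pair]; exact Part.mem_bind hb hq, hqA⟩

/-- A single instance of a coproduct reaches only one side; parallelization asks both and pairs the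
answers. -/
theorem const_oplus_leW {A B : Set Baire} (hA : A.Nonempty) (hB : B.Nonempty) :
    (const (oplus A B)).LeW (coprod (const A) (const B)).total := by
  -- Padding the identity makes component `n` decode to `cons n p`, so components `0` and `1` carry
  -- exactly the tags of the two sides.
  obtain ⟨P, hP, hPdec⟩ := IsComputable.exists_padding (show IsComputable _ from TComp.id)
  refine leW_of (H := fun v => (dec (proj 0 (snd v))).bind fun a => (dec (proj 1 (snd v))).map
      fun b => pair (tail a) (tail b))
    ((IsComputable.pair ((IsComputable.dec (.proj (.const 0) tComp_snd)).map tComp_tail)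
      ((IsComputable.dec (.proj (.const 1) tComp_snd)).map tComp_tail)).mono fun v q hq => ?_)
    hP fun p _ => ⟨nonempty_real_total _ _, fun t ht => ?_⟩
  · obtain ⟨a, ha, hq⟩ := Part.mem_bind_iff.1 hq
    obtain ⟨b, hb, rfl⟩ := (Part.mem_map_iff _).1 hq
    exact Part.mem_bind (Part.mem_map _ ha) (Part.mem_map _ (Part.mem_map _ hb))
  · obtain ⟨a, ha⟩ := hA
    obtain ⟨b, hb⟩ := hB
    obtain ⟨q, hq, hqA⟩ := mem_real_total.1 ht 0 _ (hPdec 0 p _ (Part.mem_some _))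
      ⟨cons 0 a, mem_real_coprod.2 (.inl ⟨rfl, rfl, by rwa [real_const]⟩)⟩
    obtain ⟨r, hr, hrB⟩ := mem_real_total.1 ht 1 _ (hPdec 1 p _ (Part.mem_some _))
      ⟨cons 1 b, mem_real_coprod.2 (.inr ⟨rfl, rfl, by rwa [real_const]⟩)⟩
    simp only [mem_real_coprod, cons_zero, real_const, zero_ne_one, one_ne_zero, false_and,
      or_false, false_or, true_and] at hqA hrB
    refine ⟨pair (tail q) (tail r), ?_, ?_⟩
    · rw [snd_pair]
      exact Part.mem_bind hq (Part.mem_map _ hr)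
    · rw [real_const]
      exact ⟨_, hqA.2, _, hrB.2, rfl⟩

/-- The tag on an element of `0A ∪ 1B` doubles as the tag of the disjoint union; the rest is copied
into all components. -/
theorem meet_leW_const_otimes {A B : Set Baire} (hA : A.Nonempty) :
    (meet (const A).total (const B).total).LeW (const (otimes A B)).total := by
  have hd : ∀ p, ((const (otimes A B)).real p).Nonempty := fun p => by
    obtain ⟨a, ha⟩ := hA
    rw [real_const]
    exact ⟨_, .inl ⟨a, ha, rfl⟩⟩
  refine leW_of (H := fun v => (dec (proj 0 (snd v))).map fun d =>
      cons (d 0) (replicate fun k => tail d k + 1))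
    ((IsComputable.dec (.proj (.const 0) tComp_snd)).map
      (.cons (TComp.id.apply 0) tComp_tail.succ.replicate)) tComp_succ.replicate
    fun p _ => ⟨nonempty_real_total _ _, fun t ht => ?_⟩
  obtain ⟨d, hdt, hdA⟩ := mem_real_total.1 ht 0 p mem_dec_proj_replicate (hd _)
  refine ⟨_, by rw [snd_pair]; exact Part.mem_map _ hdt, mem_real_meet.2
    ⟨nonempty_real_total _ _, nonempty_real_total _ _, ?_⟩⟩
  rw [real_const] at hdA
  obtain ⟨a, ha, rfl⟩ | ⟨b, hb, rfl⟩ := hdA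
  · refine .inl ⟨rfl, mem_real_total.2 fun n p' _ _ => ⟨a, mem_dec_proj_replicate, ?_⟩⟩
    rwa [real_const]
  · refine .inr ⟨rfl, mem_real_total.2 fun n p' _ _ => ⟨b, mem_dec_proj_replicate, ?_⟩⟩
    rwa [real_const]

/-- A value `⟨m, k, s⟩` of the implication already works for each `b ∈ B`, since the repeated `b`
answers whatever query `φₖ` poses. A fixed program `n` interprets the stored `m` and `s`. -/
theorem const_impM_leW {A B : Set Baire} (hA : A.Nonempty) :
    (const (impM B A)).LeW (mimpAux (const B).total (const A).total) := by
  obtain ⟨n, hn⟩ := isComputable_iff.1 (show IsComputable fun x =>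
      (phi (fst x 0) (pair (tail (tail (fst x))) (replicate fun k => snd x k + 1))).bind
        fun v => dec (proj 0 v) from
    (IsComputable.phi (tComp_fst.apply 0)
      (tComp_fst.tail.tail.pair tComp_snd.succ.replicate)).bind
      (.dec (.proj (.const 0) tComp_snd)))
  refine leW_of (TComp.cons (.const n) tComp_snd) tComp_succ.replicate
    fun p _ => ⟨nonempty_real_mimpAux_total _ _ _, fun t ht => ⟨_, Part.mem_some _, ?_⟩⟩
  simp only [snd_pair, real_const]
  obtain ⟨m, k, s, rfl, r, hr, -, hrt⟩ := mem_real_mimpAux.1 ht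
  refine ⟨n, _, rfl, fun b hb => ?_⟩
  obtain ⟨v, hv, hvA⟩ := hrt (replicate fun k => b k + 1) (mem_real_total.2 fun i p' _ _ =>
    ⟨b, mem_dec_proj_replicate, by rwa [real_const]⟩)
  obtain ⟨a, ha, haA⟩ := mem_real_total.1 hvA 0 p mem_dec_proj_replicate (by rwa [real_const])
  rw [real_const] at haA
  refine ⟨a, hn _ _ ?_, haA⟩
  simp only [fst_pair, snd_pair, cons_zero, tail_cons]
  exact Part.mem_bind hv ha

end Problem

/-! ### Brouwer algebras from preorders -/

/-- A preorder whose operations satisfy the laws of a Brouwer algebra up to equivalence. -/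
structure BrouwerPreorder (α : Type*) where
  le : α → α → Prop
  inf : α → α → α
  sup : α → α → α
  sdiff : α → α → α
  bot : α
  top : α
  le_refl : ∀ a, le a a
  le_trans : ∀ a b c, le a b → le b c → le a c
  inf_le_left : ∀ a b, le (inf a b) a
  inf_le_right : ∀ a b, le (inf a b) b
  le_inf : ∀ a b c, le a b → le a c → le a (inf b c)
  le_sup_left : ∀ a b, le a (sup a b)
  le_sup_right : ∀ a b, le b (sup a b)
  sup_le : ∀ a b c, le a c → le b c → le (sup a b) c
  sdiff_le_iff : ∀ a b c, le (sdiff a b) c ↔ le a (sup b c)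
  bot_le : ∀ a, le bot a
  le_top : ∀ a, le a top

namespace BrouwerPreorder

variable {α : Type*} (D : BrouwerPreorder α)

/-- Classes of mutually comparable elements. -/
abbrev Degree : Type _ := Quot fun a b : α => D.le a b ∧ D.le b a

theorem inf_mono {a a' b b' : α} (ha : D.le a a') (hb : D.le b b') :
    D.le (D.inf a b) (D.inf a' b') :=
  D.le_inf _ _ _ (D.le_trans _ _ _ (D.inf_le_left _ _) ha)
    (D.le_trans _ _ _ (D.inf_le_right _ _) hb)

theorem sup_mono {a a' b b' : α} (ha : D.le a a') (hb : D.le b b') :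
    D.le (D.sup a b) (D.sup a' b') :=
  D.sup_le _ _ _ (D.le_trans _ _ _ ha (D.le_sup_left _ _))
    (D.le_trans _ _ _ hb (D.le_sup_right _ _))

/-- Residuation alone forces monotonicity in the first and antitonicity in the second argument,
hence well-definedness on degrees. -/
theorem sdiff_mono {a a' b b' : α} (ha : D.le a a') (hb : D.le b' b) :
    D.le (D.sdiff a b) (D.sdiff a' b') :=
  (D.sdiff_le_iff _ _ _).2 (D.le_trans _ _ _ ha (D.le_trans _ _ _
    ((D.sdiff_le_iff _ _ _).1 (D.le_refl _)) (D.sup_mono hb (D.le_refl _))))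

/-- The order on the degrees. -/
def degreeLE : D.Degree → D.Degree → Prop :=
  Quot.lift₂ D.le
    (fun _ _ _ h => propext ⟨fun h' => D.le_trans _ _ _ h' h.1,
      fun h' => D.le_trans _ _ _ h' h.2⟩)
    fun _ _ _ h => propext ⟨fun h' => D.le_trans _ _ _ h.2 h', fun h' => D.le_trans _ _ _ h.1 h'⟩

/-- The Brouwer algebra of degrees. -/
abbrev coheytingAlgebra : CoheytingAlgebra D.Degree where
  le := D.degreeLE
  le_refl := by rintro ⟨a⟩; exact D.le_refl a
  le_trans := by rintro ⟨a⟩ ⟨b⟩ ⟨c⟩; exact D.le_trans a b c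
  le_antisymm := by rintro ⟨a⟩ ⟨b⟩ h h'; exact Quot.sound ⟨h, h'⟩
  inf := Quot.map₂ D.inf
    (fun _ _ _ h => ⟨D.inf_mono (D.le_refl _) h.1, D.inf_mono (D.le_refl _) h.2⟩)
    fun _ _ _ h => ⟨D.inf_mono h.1 (D.le_refl _), D.inf_mono h.2 (D.le_refl _)⟩
  sup := Quot.map₂ D.sup
    (fun _ _ _ h => ⟨D.sup_mono (D.le_refl _) h.1, D.sup_mono (D.le_refl _) h.2⟩)
    fun _ _ _ h => ⟨D.sup_mono h.1 (D.le_refl _), D.sup_mono h.2 (D.le_refl _)⟩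
  sdiff := Quot.map₂ D.sdiff
    (fun _ _ _ h => ⟨D.sdiff_mono (D.le_refl _) h.2, D.sdiff_mono (D.le_refl _) h.1⟩)
    fun _ _ _ h => ⟨D.sdiff_mono h.1 (D.le_refl _), D.sdiff_mono h.2 (D.le_refl _)⟩
  bot := Quot.mk _ D.bot
  top := Quot.mk _ D.top
  hnot := Quot.map (D.sdiff D.top)
    fun _ _ h => ⟨D.sdiff_mono (D.le_refl _) h.2, D.sdiff_mono (D.le_refl _) h.1⟩
  inf_le_left := by rintro ⟨a⟩ ⟨b⟩; exact D.inf_le_left a b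
  inf_le_right := by rintro ⟨a⟩ ⟨b⟩; exact D.inf_le_right a b
  le_inf := by rintro ⟨a⟩ ⟨b⟩ ⟨c⟩; exact D.le_inf a b c
  le_sup_left := by rintro ⟨a⟩ ⟨b⟩; exact D.le_sup_left a b
  le_sup_right := by rintro ⟨a⟩ ⟨b⟩; exact D.le_sup_right a b
  sup_le := by rintro ⟨a⟩ ⟨b⟩ ⟨c⟩; exact D.sup_le a b c
  sdiff_le_iff := by rintro ⟨a⟩ ⟨b⟩ ⟨c⟩; exact D.sdiff_le_iff a b c
  bot_le := by rintro ⟨a⟩; exact D.bot_le a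
  le_top := by rintro ⟨a⟩; exact D.le_top a
  top_sdiff := by rintro ⟨a⟩; rfl

end BrouwerPreorder

/-! ### Medvedev reducibility -/

theorem LeM.of_tComp {A B : Set Baire} {f : Baire → Baire} (hf : TComp f)
    (h : ∀ p ∈ B, f p ∈ A) : LeM A B :=
  ⟨_, hf, fun p hp => ⟨_, Part.mem_some _, h p hp⟩⟩

theorem LeM.trans {A B C : Set Baire} (hAB : LeM A B) (hBC : LeM B C) : LeM A C := by
  obtain ⟨F, hF, h⟩ := hAB
  obtain ⟨G, hG, h'⟩ := hBC
  refine ⟨_, hG.bind_const hF, fun p hp => ?_⟩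
  obtain ⟨q, hq, hqB⟩ := h' p hp
  obtain ⟨r, hr, hrA⟩ := h q hqB
  exact ⟨r, Part.mem_bind hq hr, hrA⟩

theorem LeM.nonempty {A B : Set Baire} (h : LeM A B) (hB : B.Nonempty) : A.Nonempty := by
  obtain ⟨F, -, h⟩ := h
  obtain ⟨b, hb⟩ := hB
  obtain ⟨q, -, hq⟩ := h b hb
  exact ⟨q, hq⟩

theorem leM_otimes {A B C : Set Baire} (hA : LeM C A) (hB : LeM C B) : LeM C (otimes A B) := by
  obtain ⟨F, hF, h⟩ := hA
  obtain ⟨G, hG, h'⟩ := hB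
  refine ⟨fun p => if p 0 = 0 then F (tail p) else G (tail p),
    .ite (TComp.id.apply 0) (hF.comp tComp_tail) (hG.comp tComp_tail), ?_⟩
  rintro _ (⟨a, ha, rfl⟩ | ⟨b, hb, rfl⟩)
  · simpa [cons_zero, tail_cons] using h a ha
  · simpa [cons_zero, tail_cons] using h' b hb

theorem oplus_leM {A B C : Set Baire} (hA : LeM A C) (hB : LeM B C) : LeM (oplus A B) C := by
  obtain ⟨F, hF, h⟩ := hA
  obtain ⟨G, hG, h'⟩ := hB
  refine ⟨_, hF.pair hG, fun p hp => ?_⟩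
  obtain ⟨a, ha, haA⟩ := h p hp
  obtain ⟨b, hb, hbB⟩ := h' p hp
  exact ⟨_, Part.mem_bind ha (Part.mem_map _ hb), a, haA, b, hbB, rfl⟩

/-- Currying: an element `c ∈ C` is itself the parameter of an element of `B → A`, under one fixed
program number. -/
theorem impM_leM_iff {A B C : Set Baire} : LeM (impM B A) C ↔ LeM A (oplus B C) := by
  constructor
  · rintro ⟨F, hF, h⟩
    refine ⟨fun r => (F (snd r)).bind fun w => phi (w 0) (pair (tail w) (fst r)),
      (hF.comp tComp_snd).bind (.phi (tComp_snd.apply 0) (tComp_snd.tail.pair tComp_fst.fst)), ?_⟩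
    rintro _ ⟨b, hb, c, hc, rfl⟩
    simp only [fst_pair, snd_pair]
    obtain ⟨_, hw, n, q, rfl, hwA⟩ := h c hc
    obtain ⟨v, hv, hvA⟩ := hwA b hb
    exact ⟨v, Part.mem_bind hw hv, hvA⟩
  · rintro ⟨F, hF, h⟩
    obtain ⟨n, hn⟩ := isComputable_iff.1 (hF.comp (tComp_snd.pair tComp_fst))
    refine .of_tComp (.cons (.const n) .id) fun c hc => ⟨n, c, rfl, fun b hb => ?_⟩
    obtain ⟨v, hv, hvA⟩ := h _ ⟨b, hb, c, hc, rfl⟩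
    exact ⟨v, hn _ _ (by simpa only [fst_pair, snd_pair] using hv), hvA⟩

/-- The preorder of mass problems. -/
def medvedevPreorder : BrouwerPreorder (Set Baire) where
  le := LeM
  inf := otimes
  sup := oplus
  sdiff A B := impM B A
  bot := Set.univ
  top := ∅
  le_refl _ := .of_tComp .id fun _ h => h
  le_trans _ _ _ := LeM.trans
  inf_le_left _ _ := .of_tComp (.cons (.const 0) .id) fun p hp => .inl ⟨p, hp, rfl⟩
  inf_le_right _ _ := .of_tComp (.cons (.const 1) .id) fun p hp => .inr ⟨p, hp, rfl⟩
  le_inf _ _ _ := leM_otimes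
  le_sup_left _ _ := .of_tComp tComp_fst <| by
    rintro _ ⟨a, ha, b, hb, rfl⟩; rwa [fst_pair]
  le_sup_right _ _ := .of_tComp tComp_snd <| by
    rintro _ ⟨a, ha, b, hb, rfl⟩; rwa [snd_pair]
  sup_le _ _ _ := oplus_leM
  sdiff_le_iff _ _ _ := impM_leM_iff
  bot_le _ := .of_tComp .id fun _ _ => trivial
  le_top _ := .of_tComp .id fun _ h => h.elim

/-! ### Parallelized total Weihrauch reducibility -/

namespace ExtProblem

theorem LeW.trans {f g h : ExtProblem} (hfg : f.LeW g) (hgh : g.LeW h) : f.LeW h := by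
  rcases f with f | _ <;> rcases g with g | _ <;> rcases h with h | _ <;>
    first
      | trivial
      | exact hfg.elim
      | exact hgh.elim
      | exact Problem.LeW.trans hfg hgh

theorem leW_parCompl (f : ExtProblem) : f.LeW f.parCompl := by
  rcases f with f | _
  · exact f.leW_total
  · trivial

theorem LePtW.of_leW {f g : ExtProblem} (h : f.LeW g) : f.LePtW g := h.trans g.leW_parCompl

theorem LePtW.refl (f : ExtProblem) : f.LePtW f := f.leW_parCompl

theorem lePtW_infty (f : ExtProblem) : f.LePtW infty := by
  cases f <;> trivial

theorem LePtW.parCompl {f g : ExtProblem} (h : f.LePtW g) : f.parCompl.LeW g.parCompl := by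
  rcases f with f | _ <;> rcases g with g | _
  · exact Problem.LeW.total h
  · trivial
  · exact h.elim
  · trivial

theorem LePtW.trans {f g h : ExtProblem} (hfg : f.LePtW g) (hgh : g.LePtW h) : f.LePtW h :=
  LeW.trans hfg hgh.parCompl

theorem ptMeet_lePtW_left (f g : ExtProblem) : (f.ptMeet g).LePtW f := by
  rcases f with f | _ <;> rcases g with g | _
  · exact Problem.meet_leW_left _ _
  · exact (LePtW.refl (of f)).parCompl
  · trivial
  · trivial

theorem ptMeet_lePtW_right (f g : ExtProblem) : (f.ptMeet g).LePtW g := by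
  rcases f with f | _ <;> rcases g with g | _
  · exact Problem.meet_leW_right _ _
  · trivial
  · exact (LePtW.refl (of g)).parCompl
  · trivial

theorem lePtW_ptMeet {f g h : ExtProblem} (hf : h.LePtW f) (hg : h.LePtW g) :
    h.LePtW (f.ptMeet g) := by
  refine LePtW.of_leW ?_
  rcases f with f | _ <;> rcases g with g | _
  · rcases h with h | _
    · exact Problem.leW_meet hf hg
    · exact hf.elim
  · exact hf
  · exact hg
  · trivial

theorem lePtW_coprod_left (f g : ExtProblem) : f.LePtW (f.coprod g) := by
  refine LePtW.of_leW ?_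
  rcases f with f | _ <;> rcases g with g | _
  · exact Problem.leW_coprod_left _ _
  all_goals trivial

theorem lePtW_coprod_right (f g : ExtProblem) : g.LePtW (f.coprod g) := by
  refine LePtW.of_leW ?_
  rcases f with f | _ <;> rcases g with g | _
  · exact Problem.leW_coprod_right _ _
  all_goals trivial

theorem coprod_lePtW {f g h : ExtProblem} (hf : f.LePtW h) (hg : g.LePtW h) :
    (f.coprod g).LePtW h := by
  rcases f with f | _ <;> rcases g with g | _ <;> rcases h with h | _
  · exact Problem.coprod_leW hf hg
  all_goals trivial

/-- The exceptional value `∞` never occurs, because a total problem has nonempty domain. -/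
theorem ptImp_of_of (f g : Problem) :
    (of g).ptImp (of f) = of (Problem.mimpAux g.total f.total) := by
  refine if_neg fun h => ?_
  obtain ⟨x, -, hx⟩ := Problem.nonempty_real.1 (g.nonempty_real_total fun _ => 0)
  have : x ∈ g.total.dom := hx
  rw [show g.total.dom = ∅ from h.1] at this
  exact this

theorem ptImp_lePtW_iff {f g h : ExtProblem} :
    (g.ptImp f).LePtW h ↔ f.LePtW (g.coprod h) := by
  rcases g with g | _
  · rcases f with f | _
    · rw [ptImp_of_of]
      rcases h with h | _
      · exact ⟨Problem.leW_coprod_of_mimpAux_leW, Problem.mimpAux_leW_of_leW_coprod⟩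
      · exact iff_of_true trivial trivial
    · rcases h with h | _
      · exact Iff.rfl
      · exact iff_of_true trivial trivial
  -- For `g = ∞` the implication is the nowhere defined problem, which reduces to everything, and
  -- the join is `∞`.
  · refine iff_of_true ?_ (by cases f <;> trivial)
    rcases h with h | _
    · refine Problem.leW_total_of_computable TComp.id (fun p hp => ?_) h
      rw [Problem.real_zero] at hp
      exact absurd hp Set.not_nonempty_empty
    · trivial

theorem one_lePtW (f : ExtProblem) : (of Problem.one).LePtW f := by
  rcases f with f | _
  · exact Problem.leW_total_of_computable TComp.id
      (fun p _ => ⟨p, Part.mem_some _, Problem.mem_real_one.2 rfl⟩) f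
  · trivial

end ExtProblem

/-- The preorder of problems. -/
noncomputable def ptWPreorder : BrouwerPreorder ExtProblem where
  le := ExtProblem.LePtW
  inf := ExtProblem.ptMeet
  sup := ExtProblem.coprod
  sdiff f g := g.ptImp f
  bot := .of .one
  top := .infty
  le_refl := ExtProblem.LePtW.refl
  le_trans _ _ _ := ExtProblem.LePtW.trans
  inf_le_left := ExtProblem.ptMeet_lePtW_left
  inf_le_right := ExtProblem.ptMeet_lePtW_right
  le_inf _ _ _ := ExtProblem.lePtW_ptMeet
  le_sup_left := ExtProblem.lePtW_coprod_left
  le_sup_right := ExtProblem.lePtW_coprod_right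
  sup_le _ _ _ := ExtProblem.coprod_lePtW
  sdiff_le_iff _ _ _ := ExtProblem.ptImp_lePtW_iff
  bot_le := ExtProblem.one_lePtW
  le_top := ExtProblem.lePtW_infty

/-! ### The embedding -/

theorem cProblem_of_nonempty {A : Set Baire} (hA : A.Nonempty) :
    cProblem A = .of (.const A) := if_neg hA.ne_empty

theorem cProblem_empty : cProblem ∅ = .infty := if_pos rfl

theorem cProblem_lePtW_iff {A B : Set Baire} : (cProblem A).LePtW (cProblem B) ↔ LeM A B := by
  obtain rfl | hB := B.eq_empty_or_nonempty
  · rw [cProblem_empty]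
    exact iff_of_true (ExtProblem.lePtW_infty _) (medvedevPreorder.le_top _)
  · rw [cProblem_of_nonempty hB]
    obtain rfl | hA := A.eq_empty_or_nonempty
    · rw [cProblem_empty]
      exact iff_of_false (fun h => h) fun h => Set.not_nonempty_empty (h.nonempty hB)
    · rw [cProblem_of_nonempty hA]
      exact Problem.const_leW_total_const_iff hA hB

theorem cProblem_univ_lePtW (f : ExtProblem) : (cProblem Set.univ).LePtW f := by
  rw [cProblem_of_nonempty Set.univ_nonempty]
  rcases f with f | _
  · refine Problem.leW_total_of_computable TComp.id (fun p _ => ⟨p, Part.mem_some _, ?_⟩) f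
    rw [Problem.real_const]
    trivial
  · trivial

theorem cProblem_oplus_lePtW (A B : Set Baire) :
    (cProblem (oplus A B)).LePtW ((cProblem A).coprod (cProblem B)) := by
  obtain rfl | hA := A.eq_empty_or_nonempty
  · rw [cProblem_empty]; exact ExtProblem.lePtW_infty _
  obtain rfl | hB := B.eq_empty_or_nonempty
  · rw [cProblem_empty, cProblem_of_nonempty hA]; exact ExtProblem.lePtW_infty _
  rw [cProblem_of_nonempty hA, cProblem_of_nonempty hB,
    cProblem_of_nonempty (A := oplus A B)
      (hA.elim fun a ha => hB.elim fun b hb => ⟨_, a, ha, b, hb, rfl⟩)]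
  exact Problem.const_oplus_leW hA hB

theorem ptMeet_cProblem_lePtW (A B : Set Baire) :
    ((cProblem A).ptMeet (cProblem B)).LePtW (cProblem (otimes A B)) := by
  obtain rfl | hA := A.eq_empty_or_nonempty
  · refine (ExtProblem.ptMeet_lePtW_right _ _).trans (cProblem_lePtW_iff.2 ?_)
    exact medvedevPreorder.le_inf _ _ _ (medvedevPreorder.le_top _) (medvedevPreorder.le_refl _)
  obtain rfl | hB := B.eq_empty_or_nonempty
  · refine (ExtProblem.ptMeet_lePtW_left _ _).trans (cProblem_lePtW_iff.2 ?_)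
    exact medvedevPreorder.le_inf _ _ _ (medvedevPreorder.le_refl _) (medvedevPreorder.le_top _)
  rw [cProblem_of_nonempty hA, cProblem_of_nonempty hB,
    cProblem_of_nonempty (A := otimes A B) (hA.elim fun a ha => ⟨_, .inl ⟨a, ha, rfl⟩⟩)]
  exact Problem.meet_leW_const_otimes hA

theorem cProblem_impM_lePtW (A B : Set Baire) :
    (cProblem (impM B A)).LePtW ((cProblem B).ptImp (cProblem A)) := by
  obtain rfl | hB := B.eq_empty_or_nonempty
  · refine .trans (cProblem_lePtW_iff.2 ?_) (cProblem_univ_lePtW _)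
    -- For `B = ∅` the implication is the bottom degree, since `∅` is already above `A`.
    exact impM_leM_iff.2 ((medvedevPreorder.le_top A).trans
      (medvedevPreorder.le_sup_left ∅ Set.univ))
  obtain rfl | hA := A.eq_empty_or_nonempty
  · rw [cProblem_empty, cProblem_of_nonempty hB]
    exact ExtProblem.lePtW_infty _
  -- As `A` is below `B ⊕ A`, residuation makes `B → A` reducible to the nonempty `A`.
  · have h : (impM B A).Nonempty :=
      (impM_leM_iff.2 (medvedevPreorder.le_sup_right B A)).nonempty hA
    rw [cProblem_of_nonempty hA, cProblem_of_nonempty hB, cProblem_of_nonempty h,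
      ExtProblem.ptImp_of_of]
    exact (Problem.const_impM_leW hA).trans (Problem.leW_total _)

/-- The degree of `c_A` as a function of the Medvedev degree of `A`. -/
noncomputable def cDegree : MedvedevDegree → PtWDegree :=
  Quot.map cProblem fun _ _ h => ⟨cProblem_lePtW_iff.2 h.1, cProblem_lePtW_iff.2 h.2⟩

end MedvedevWeihrauch

/-! ### The embedding theorem -/

theorem mainTheorem2 :
    ∃ (M : CoheytingAlgebra MedvedevDegree) (W : CoheytingAlgebra PtWDegree),
      IsMedvedevAlgebra M ∧ IsPtWAlgebra W ∧
      ∃ c : MedvedevDegree → PtWDegree,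
        (∀ A : Set Baire, c (MedvedevDegree.mk A) = PtWDegree.mk (cProblem A)) ∧
        Function.Injective c ∧
        (∀ a b : MedvedevDegree, a ≤ b ↔ c a ≤ c b) ∧
        (∀ a b : MedvedevDegree, c (a ⊓ b) = c a ⊓ c b) ∧
        (∀ a b : MedvedevDegree, c (a ⊔ b) = c a ⊔ c b) ∧
        (∀ a b : MedvedevDegree, c (a \ b) = c a \ c b) ∧
        c ⊥ = ⊥ ∧ c ⊤ = ⊤ := by
  have hle (A B : Set Baire) : (cProblem A).LePtW (cProblem B) ↔ LeM A B := cProblem_lePtW_iff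
  refine ⟨medvedevPreorder.coheytingAlgebra, ptWPreorder.coheytingAlgebra,
    ⟨fun _ _ => Iff.rfl, fun _ _ => rfl, fun _ _ => rfl, fun _ _ => rfl, rfl, rfl⟩,
    ⟨fun _ _ => Iff.rfl, fun _ _ => rfl, fun _ _ => rfl, fun _ _ => rfl, rfl, rfl⟩,
    cDegree, fun _ => rfl, ?_, ?_, ?_, ?_, ?_, ?_, ?_⟩
  · rintro ⟨A⟩ ⟨B⟩ h
    -- Equal degrees are comparable because the order is well defined on the quotient; this recovers
    -- mutual reducibility of representatives.
    have key : ∀ d e : ptWPreorder.Degree, d = e → ptWPreorder.degreeLE d e := by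
      rintro ⟨f⟩ _ rfl
      exact ptWPreorder.le_refl f
    exact Quot.sound ⟨(hle A B).1 (key _ _ h), (hle B A).1 (key _ _ h.symm)⟩
  · rintro ⟨A⟩ ⟨B⟩
    exact (hle A B).symm
  · rintro ⟨A⟩ ⟨B⟩
    exact Quot.sound ⟨ExtProblem.lePtW_ptMeet
      ((hle _ _).2 (medvedevPreorder.inf_le_left A B))
      ((hle _ _).2 (medvedevPreorder.inf_le_right A B)), ptMeet_cProblem_lePtW A B⟩
  · rintro ⟨A⟩ ⟨B⟩
    exact Quot.sound ⟨cProblem_oplus_lePtW A B, ExtProblem.coprod_lePtW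
      ((hle _ _).2 (medvedevPreorder.le_sup_left A B))
      ((hle _ _).2 (medvedevPreorder.le_sup_right A B))⟩
  · rintro ⟨A⟩ ⟨B⟩
    refine Quot.sound ⟨cProblem_impM_lePtW A B, ExtProblem.ptImp_lePtW_iff.2 ?_⟩
    -- By residuation it suffices to bound `c_A` by `c_B ⊔ c_{B → A}`; modus ponens for mass
    -- problems, followed by preservation of joins, does so.
    exact ((hle _ _).2 (impM_leM_iff.1 (medvedevPreorder.le_refl _))).trans
      (cProblem_oplus_lePtW B (impM B A))
  · exact Quot.sound ⟨cProblem_univ_lePtW _, ExtProblem.one_lePtW _⟩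
  · exact congrArg PtWDegree.mk cProblem_empty
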